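/- For a C*-algebra $A$, let $\mathrm{Cu}(A)$ denote its Cuntz semigroup: the set of classes $[a]$ of positive elements $a\in A\otimes\mathcal K$ modulo Cuntz equivalence, where $\mathcal K$ is the algebra of compact operators on a separable infinite-dimensional Hilbert space. Here $[a]\le[b]$ means that $d_n^*bd_n\to a$ for some sequence $(d_n)$ in $A\otimes\mathcal K$, and $[a]+[b]:=[a'+b']$ where $a',b'$ are mutually orthogonal positive elements that are Murray–von Neumann equivalent to $a$ and $b$ respectively. The algebra $A$ is identified with the top left corner of $A\otimes\mathcal K$. For a *-homomorphism $\phi\colon A\to B$ put $\mathrm{Cu}(\phi)([a])=[(\phi\otimes\mathrm{id}_{\mathcal K})(a)]$. A Cu-morphism $\mathrm{Cu}(A)\to\mathrm{Cu}(B)$ is an order preserving additive map that preserves $0$, suprema of increasing sequences, and the far below relation $\ll$, where $x\ll y$ means that whenever $(y_n)$ is an increasing sequence with $y\le\sup_n y_n$, there is $k$ with $x\le y_k$. For $t\ge 0$ let $e_t\in C_0(0,1]$ be $e_t(x)=\max(x-t,0)$, and let $\mathrm{id}=e_0$ be the function $\mathrm{id}(x)=x$. For maps $\alpha,\beta\colon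 \mathrm{Cu}(C_0(0,1])\to\mathrm{Cu}(A)$ put $$d_W(\alpha,\beta)=\inf\{r\ge 0 : \alpha([e_{t+r}])\le\beta([e_t])\ \text{and}\ \beta([e_{t+r}])\le\alpha([e_t])\ \text{for all } t\ge 0\}.$$ **Theorem.** Let $A$ be a C*-algebra and let $h_A\in A$ be a strictly positive element (that is, $h_A\ge 0$ and $h_AAh_A$ is dense in $A$). Let $\alpha\colon\mathrm{Cu}(C_0(0,1])\to\mathrm{Cu}(A)$ be a Cu-morphism such that $\alpha([\mathrm{id}])\le[h_A]$. Then for every $\varepsilon>0$ there exists a *-homomorphism $\phi\colon C_0(0,1]\to A$ such that $d_W(\mathrm{Cu}(\phi),\alpha)<\varepsilon$. -/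

import Mathlib

namespace CuntzSemigroup

noncomputable section

open Filter Topology
open scoped ENNReal ZeroAtInfty

section Corona

variable (B : ℕ → Type*) [∀ n, NonUnitalCStarAlgebra (B n)]

/-- The bounded sequences `(x n)` with `‖x n‖ → 0`, as a subspace of the `ℓ^∞`-product. -/
def nullSeq : Submodule ℂ (lp B ∞) where
  carrier := {x | Tendsto (fun n => ‖x n‖) atTop (𝓝 0)}
  zero_mem' := by simp
  add_mem' := by
    intro x y hx hy
    refine squeeze_zero (fun n => norm_nonneg _) (fun n => norm_add_le (x n) (y n)) ?_
    simpa using hx.add hy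
  smul_mem' := by
    intro c x hx
    have h : Tendsto (fun n => ‖c‖ * ‖x n‖) atTop (𝓝 (‖c‖ * 0)) := hx.const_mul _
    simpa [norm_smul] using h

variable {B}

theorem mem_nullSeq {x : lp B ∞} :
    x ∈ nullSeq B ↔ Tendsto (fun n => ‖x n‖) atTop (𝓝 0) := Iff.rfl

instance isClosed_nullSeq : IsClosed (nullSeq B : Set (lp B ∞)) := by
  refine isClosed_of_closure_subset fun x hx => ?_
  rw [SetLike.mem_coe, mem_nullSeq, Metric.tendsto_atTop]
  intro ε hε
  obtain ⟨y, hy, hxy⟩ := Metric.mem_closure_iff.1 hx (ε / 2) (half_pos hε)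
  obtain ⟨N, hN⟩ := Metric.tendsto_atTop.1 (mem_nullSeq.1 hy) (ε / 2) (half_pos hε)
  refine ⟨N, fun n hn => ?_⟩
  have h1 := hN n hn
  have h2 : ‖x n - y n‖ ≤ ‖x - y‖ := lp.norm_apply_le_norm (by simp) (x - y) n
  rw [dist_eq_norm] at hxy
  have h3 : ‖x n‖ ≤ ‖x n - y n‖ + ‖y n‖ := by
    simpa using norm_add_le (x n - y n) (y n)
  simp only [Real.dist_eq, sub_zero, abs_norm] at h1 ⊢
  linarith

theorem mul_mem_nullSeq_left {x : lp B ∞} (y : lp B ∞) (hx : x ∈ nullSeq B) :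
    x * y ∈ nullSeq B := by
  have h : Tendsto (fun n => ‖x n‖ * ‖y‖) atTop (𝓝 (0 * ‖y‖)) := hx.mul_const _
  rw [zero_mul] at h
  refine squeeze_zero (fun n => norm_nonneg _) (fun n => ?_) h
  refine (norm_mul_le (x n) (y n)).trans ?_
  exact mul_le_mul_of_nonneg_left (lp.norm_apply_le_norm (by simp) y n) (norm_nonneg _)

theorem mul_mem_nullSeq_right (x : lp B ∞) {y : lp B ∞} (hy : y ∈ nullSeq B) :
    x * y ∈ nullSeq B := by
  have h : Tendsto (fun n => ‖x‖ * ‖y n‖) atTop (𝓝 (‖x‖ * 0)) := hy.const_mul _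
  rw [mul_zero] at h
  refine squeeze_zero (fun n => norm_nonneg _) (fun n => ?_) h
  refine (norm_mul_le (x n) (y n)).trans ?_
  exact mul_le_mul_of_nonneg_right (lp.norm_apply_le_norm (by simp) x n) (norm_nonneg _)

theorem star_mem_nullSeq {x : lp B ∞} (hx : x ∈ nullSeq B) : star x ∈ nullSeq B := by
  have h : (fun n => ‖(star x) n‖) = fun n => ‖x n‖ := by
    funext n
    simp [lp.star_apply]
  rw [mem_nullSeq, h]
  exact hx

variable (B)

/-- The C*-algebra of bounded sequences modulo null sequences, `∏ B n / ⨁ B n`, with the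
quotient norm. -/
abbrev Corona : Type _ := lp B ∞ ⧸ nullSeq B

variable {B}

instance : Mul (Corona B) where
  mul := Quotient.map₂ (· * ·) (by
    intro a b hab c d hcd
    change (nullSeq B).quotientRel a b at hab
    change (nullSeq B).quotientRel c d at hcd
    change (nullSeq B).quotientRel (a * c) (b * d)
    rw [Submodule.quotientRel_def] at *
    have h : a * c - b * d = (a - b) * c + b * (c - d) := by
      rw [sub_mul, mul_sub]; abel
    rw [h]
    exact add_mem (mul_mem_nullSeq_left _ hab) (mul_mem_nullSeq_right _ hcd))

instance : Star (Corona B) where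
  star := Quotient.map star (by
    intro a b hab
    change (nullSeq B).quotientRel a b at hab
    change (nullSeq B).quotientRel (star a) (star b)
    rw [Submodule.quotientRel_def] at *
    rw [← star_sub]
    exact star_mem_nullSeq hab)

/-- The class in the corona of a bounded sequence. -/
def Corona.mk (x : lp B ∞) : Corona B := Submodule.Quotient.mk x

theorem Corona.mk_surj (q : Corona B) : ∃ x, Corona.mk x = q :=
  Submodule.Quotient.mk_surjective _ q

theorem Corona.mk_mul (x y : lp B ∞) : Corona.mk (x * y) = Corona.mk x * Corona.mk y := rfl
theorem Corona.mk_star (x : lp B ∞) : Corona.mk (star x) = star (Corona.mk x) := rfl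
theorem Corona.mk_add (x y : lp B ∞) : Corona.mk (x + y) = Corona.mk x + Corona.mk y := rfl
theorem Corona.mk_smul (c : ℂ) (x : lp B ∞) : Corona.mk (c • x) = c • Corona.mk x := rfl
theorem Corona.mk_zero : Corona.mk (0 : lp B ∞) = 0 := rfl

theorem Corona.norm_mk_le (x : lp B ∞) : ‖Corona.mk x‖ ≤ ‖x‖ :=
  Submodule.Quotient.norm_mk_le _ _

theorem Corona.exists_rep (q : Corona B) {ε : ℝ} (hε : 0 < ε) :
    ∃ x, Corona.mk x = q ∧ ‖x‖ < ‖q‖ + ε :=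
  Submodule.Quotient.norm_mk_lt q hε

instance : NonUnitalRing (Corona B) where
  left_distrib a b c := by
    obtain ⟨a, rfl⟩ := Corona.mk_surj a
    obtain ⟨b, rfl⟩ := Corona.mk_surj b
    obtain ⟨c, rfl⟩ := Corona.mk_surj c
    simp only [← Corona.mk_mul, ← Corona.mk_add, mul_add]
  right_distrib a b c := by
    obtain ⟨a, rfl⟩ := Corona.mk_surj a
    obtain ⟨b, rfl⟩ := Corona.mk_surj b
    obtain ⟨c, rfl⟩ := Corona.mk_surj c
    simp only [← Corona.mk_mul, ← Corona.mk_add, add_mul]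
  zero_mul a := by
    obtain ⟨a, rfl⟩ := Corona.mk_surj a
    simp only [← Corona.mk_mul, ← Corona.mk_zero, zero_mul]
  mul_zero a := by
    obtain ⟨a, rfl⟩ := Corona.mk_surj a
    simp only [← Corona.mk_mul, ← Corona.mk_zero, mul_zero]
  mul_assoc a b c := by
    obtain ⟨a, rfl⟩ := Corona.mk_surj a
    obtain ⟨b, rfl⟩ := Corona.mk_surj b
    obtain ⟨c, rfl⟩ := Corona.mk_surj c
    simp only [← Corona.mk_mul, mul_assoc]

instance : NonUnitalNormedRing (Corona B) where
  __ : NonUnitalRing (Corona B) := inferInstance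
  __ : NormedAddCommGroup (Corona B) := inferInstance
  norm_mul_le a b := by
    have key : ∀ ε > 0, ‖a * b‖ ≤ (‖a‖ + ε) * (‖b‖ + ε) := by
      intro ε hε
      obtain ⟨x, rfl, hx⟩ := Corona.exists_rep a hε
      obtain ⟨y, rfl, hy⟩ := Corona.exists_rep b hε
      rw [← Corona.mk_mul]
      refine (Corona.norm_mk_le _).trans ((norm_mul_le x y).trans ?_)
      gcongr
    have hlim : Tendsto (fun ε : ℝ => (‖a‖ + ε) * (‖b‖ + ε)) (𝓝[>] 0)
        (𝓝 ((‖a‖ + 0) * (‖b‖ + 0))) := by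
      refine Tendsto.mono_left (Continuous.tendsto ?_ 0) nhdsWithin_le_nhds
      fun_prop
    simp only [add_zero] at hlim
    exact ge_of_tendsto hlim (eventually_mem_nhdsWithin.mono key)

instance : StarRing (Corona B) where
  star_involutive a := by
    obtain ⟨a, rfl⟩ := Corona.mk_surj a
    simp only [← Corona.mk_star, star_star]
  star_mul a b := by
    obtain ⟨a, rfl⟩ := Corona.mk_surj a
    obtain ⟨b, rfl⟩ := Corona.mk_surj b
    simp only [← Corona.mk_star, ← Corona.mk_mul, star_mul]
  star_add a b := by
    obtain ⟨a, rfl⟩ := Corona.mk_surj a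
    obtain ⟨b, rfl⟩ := Corona.mk_surj b
    simp only [← Corona.mk_star, ← Corona.mk_add, star_add]

/-- Deleting finitely many terms of a bounded sequence does not change its class. -/
theorem Corona.norm_mk_le_of_eventually {x : lp B ∞} {C : ℝ} (hC : 0 ≤ C)
    (h : ∀ᶠ n in atTop, ‖x n‖ ≤ C) : ‖Corona.mk x‖ ≤ C := by
  obtain ⟨N, hN⟩ := eventually_atTop.1 h
  let f : ∀ n, B n := fun n => if N ≤ n then x n else 0
  have hf : ∀ n, ‖f n‖ ≤ C := by
    intro n
    by_cases hn : N ≤ n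
    · simpa [f, hn] using hN n hn
    · simpa [f, hn] using hC
  have hmem : Memℓp f ∞ := memℓp_infty ⟨C, by rintro _ ⟨n, rfl⟩; exact hf n⟩
  let y : lp B ∞ := ⟨f, hmem⟩
  have hxy : Corona.mk x = Corona.mk y := by
    refine (Submodule.Quotient.eq _).2 ?_
    refine mem_nullSeq.2 (tendsto_const_nhds.congr' ?_)
    filter_upwards [eventually_ge_atTop N] with n hn
    have : (x - y) n = x n - f n := rfl
    rw [this]
    simp [f, hn]
  rw [hxy]
  exact (Corona.norm_mk_le y).trans (lp.norm_le_of_forall_le hC hf)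

instance : CStarRing (Corona B) where
  norm_mul_self_le a := by
    have key : ∀ ε > 0, ‖a‖ ≤ √(‖star a * a‖ + ε + ε) := by
      intro ε hε
      obtain ⟨x, rfl⟩ := Corona.mk_surj a
      obtain ⟨y, hy, hyn⟩ := Corona.exists_rep (star (Corona.mk x) * Corona.mk x) hε
      rw [← Corona.mk_star, ← Corona.mk_mul] at hy
      have hnull : star x * x - y ∈ nullSeq B := (Submodule.Quotient.eq _).1 hy.symm
      refine Corona.norm_mk_le_of_eventually (Real.sqrt_nonneg _) ?_
      have hev := (tendsto_order.1 (mem_nullSeq.1 hnull)).2 ε hε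
      filter_upwards [hev] with n hn
      refine Real.le_sqrt_of_sq_le ?_
      have h1 : ‖x n‖ ^ 2 = ‖star (x n) * x n‖ := by
        rw [CStarRing.norm_star_mul_self, sq]
      have h2 : ‖star (x n) * x n‖ ≤ ‖(star x * x - y) n‖ + ‖y n‖ := by
        have h3 : (star x * x - y) n + y n = star (x n) * x n := by
          change (star (x n) * x n - y n) + y n = _
          exact sub_add_cancel _ _
        rw [← h3]
        exact norm_add_le _ _
      have h3 : ‖y n‖ ≤ ‖y‖ := lp.norm_apply_le_norm (by simp) y n
      linarith
    have hlim : Tendsto (fun ε : ℝ => √(‖star a * a‖ + ε + ε)) (𝓝[>] 0)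
        (𝓝 (√(‖star a * a‖ + 0 + 0))) := by
      refine Tendsto.mono_left (Continuous.tendsto ?_ 0) nhdsWithin_le_nhds
      fun_prop
    simp only [add_zero] at hlim
    have h := ge_of_tendsto hlim (eventually_mem_nhdsWithin.mono key)
    have h2 := mul_self_le_mul_self (norm_nonneg a) h
    rwa [Real.mul_self_sqrt (norm_nonneg _)] at h2

instance : NonUnitalCStarAlgebra (Corona B) where
  __ : NonUnitalNormedRing (Corona B) := inferInstance
  __ : StarRing (Corona B) := inferInstance
  __ : CStarRing (Corona B) := inferInstance
  __ : NormedSpace ℂ (Corona B) := inferInstance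
  __ : CompleteSpace (Corona B) := inferInstance
  smul_assoc c a b := by
    obtain ⟨a, rfl⟩ := Corona.mk_surj a
    obtain ⟨b, rfl⟩ := Corona.mk_surj b
    simp only [smul_eq_mul, ← Corona.mk_mul, ← Corona.mk_smul, smul_mul_assoc]
  smul_comm c a b := by
    obtain ⟨a, rfl⟩ := Corona.mk_surj a
    obtain ⟨b, rfl⟩ := Corona.mk_surj b
    simp only [smul_eq_mul, ← Corona.mk_mul, ← Corona.mk_smul, mul_smul_comm]
  star_smul c a := by
    obtain ⟨a, rfl⟩ := Corona.mk_surj a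
    simp only [← Corona.mk_star, ← Corona.mk_smul, star_smul]

section CoronaMap

variable {C : ℕ → Type*} [∀ n, NonUnitalCStarAlgebra (C n)]

/-- Termwise application of *-homomorphisms to bounded sequences. -/
def seqMap (ψ : ∀ n, B n →⋆ₙₐ[ℂ] C n) (x : lp B ∞) : lp C ∞ :=
  ⟨fun n => ψ n (x n), memℓp_infty ⟨‖x‖, by
    rintro _ ⟨n, rfl⟩
    exact (NonUnitalStarAlgHom.norm_apply_le (ψ n) (x n)).trans
      (lp.norm_apply_le_norm (by simp) x n)⟩⟩

theorem seqMap_mem_nullSeq (ψ : ∀ n, B n →⋆ₙₐ[ℂ] C n) {x : lp B ∞} (hx : x ∈ nullSeq B) :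
    seqMap ψ x ∈ nullSeq C :=
  squeeze_zero (fun _ => norm_nonneg _)
    (fun n => NonUnitalStarAlgHom.norm_apply_le (ψ n) (x n)) hx

theorem seqMap_sub (ψ : ∀ n, B n →⋆ₙₐ[ℂ] C n) (x y : lp B ∞) :
    seqMap ψ (x - y) = seqMap ψ x - seqMap ψ y :=
  Subtype.ext (funext fun n => map_sub (ψ n) (x n) (y n))

/-- The *-homomorphism of coronas induced by a sequence of *-homomorphisms. -/
def Corona.map (ψ : ∀ n, B n →⋆ₙₐ[ℂ] C n) : Corona B →⋆ₙₐ[ℂ] Corona C where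
  toFun := Quotient.map (seqMap ψ) (by
    intro a b hab
    change (nullSeq B).quotientRel a b at hab
    change (nullSeq C).quotientRel (seqMap ψ a) (seqMap ψ b)
    rw [Submodule.quotientRel_def] at *
    rw [← seqMap_sub]
    exact seqMap_mem_nullSeq ψ hab)
  map_smul' c a := by
    obtain ⟨a, rfl⟩ := Corona.mk_surj a
    exact congrArg Corona.mk
      (Subtype.ext (funext fun n => map_smul (ψ n) c (a n)) : seqMap ψ (c • a) = c • seqMap ψ a)
  map_zero' := congrArg Corona.mk
    (Subtype.ext (funext fun n => map_zero (ψ n)) : seqMap ψ 0 = 0)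
  map_add' a b := by
    obtain ⟨a, rfl⟩ := Corona.mk_surj a
    obtain ⟨b, rfl⟩ := Corona.mk_surj b
    exact congrArg Corona.mk
      (Subtype.ext (funext fun n => map_add (ψ n) (a n) (b n)) :
        seqMap ψ (a + b) = seqMap ψ a + seqMap ψ b)
  map_mul' a b := by
    obtain ⟨a, rfl⟩ := Corona.mk_surj a
    obtain ⟨b, rfl⟩ := Corona.mk_surj b
    exact congrArg Corona.mk
      (Subtype.ext (funext fun n => map_mul (ψ n) (a n) (b n)) :
        seqMap ψ (a * b) = seqMap ψ a * seqMap ψ b)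
  map_star' a := by
    obtain ⟨a, rfl⟩ := Corona.mk_surj a
    exact congrArg Corona.mk
      (Subtype.ext (funext fun n => map_star (ψ n) (a n)) :
        seqMap ψ (star a) = star (seqMap ψ a))

theorem Corona.map_mk (ψ : ∀ n, B n →⋆ₙₐ[ℂ] C n) (x : lp B ∞) :
    Corona.map ψ (Corona.mk x) = Corona.mk (seqMap ψ x) := rfl

end CoronaMap

end Corona

section Stabilization

variable (A : Type*) [NonUnitalCStarAlgebra A]

/-- The matrix algebras `M_n(A)`. -/
abbrev Mat (n : ℕ) : Type _ := CStarMatrix (Fin n) (Fin n) A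

variable {A}

/-- The `n × n` matrix whose `(i, j)` entry is `a` and whose other entries are zero (it is the zero
matrix if `i` or `j` is not below `n`). -/
def elemMat (i j : ℕ) (a : A) (n : ℕ) : Mat A n :=
  CStarMatrix.ofMatrix fun k l => if k.val = i ∧ l.val = j then a else 0

theorem elemMat_apply (i j : ℕ) (a : A) (n : ℕ) (k l : Fin n) :
    elemMat i j a n k l = if k.val = i ∧ l.val = j then a else 0 := rfl

theorem elemMat_mul (i j : ℕ) (a b : A) (n : ℕ) (l : ℕ) (hj : j < n) :
    elemMat i j a n * elemMat j l b n = elemMat i l (a * b) n := by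
  ext r s
  rw [CStarMatrix.mul_apply, Finset.sum_eq_single (⟨j, hj⟩ : Fin n)]
  · simp only [elemMat_apply, and_true, true_and]
    by_cases h1 : r.val = i <;> by_cases h2 : s.val = l <;> simp [h1, h2]
  · intro k _ hk
    have hk' : k.val ≠ j := fun h => hk (Fin.ext h)
    simp [elemMat_apply, hk']
  · simp

theorem elemMat_eq_zero (i j : ℕ) (a : A) (n : ℕ) (h : ¬ (i < n ∧ j < n)) :
    elemMat i j a n = 0 := by
  ext r s
  rw [elemMat_apply, if_neg]
  · rfl
  · rintro ⟨h1, h2⟩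
    exact h ⟨h1 ▸ r.isLt, h2 ▸ s.isLt⟩

theorem elemMat_star (i j : ℕ) (a : A) (n : ℕ) :
    star (elemMat i j a n) = elemMat j i (star a) n := by
  ext r s
  rw [CStarMatrix.star_apply, elemMat_apply, elemMat_apply]
  by_cases h1 : r.val = j <;> by_cases h2 : s.val = i <;> simp [h1, h2]

variable [PartialOrder A] [StarOrderedRing A]

/-- The *-homomorphism placing an element at the `i`-th diagonal entry. -/
def diagHom (i n : ℕ) : A →⋆ₙₐ[ℂ] Mat A n where
  toFun a := elemMat i i a n
  map_smul' c a := by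
    ext r s
    simp only [CStarMatrix.smul_apply, elemMat_apply]
    split_ifs <;> simp
  map_zero' := by
    ext r s
    simp [elemMat_apply]
  map_add' a b := by
    ext r s
    simp only [CStarMatrix.add_apply, elemMat_apply]
    split_ifs <;> simp
  map_mul' a b := by
    by_cases h : i < n
    · exact (elemMat_mul i i a b n i h).symm
    · rw [elemMat_eq_zero _ _ _ _ (by simp [h]), elemMat_eq_zero _ _ _ _ (by simp [h]),
        zero_mul]
  map_star' a := (elemMat_star i i a n).symm

theorem norm_elemMat_le (i j : ℕ) (a : A) (n : ℕ) : ‖elemMat i j a n‖ ≤ ‖a‖ := by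
  by_cases h : i < n
  · have h1 : ‖elemMat i j a n‖ * ‖elemMat i j a n‖ ≤ ‖a‖ * ‖a‖ := by
      rw [← CStarRing.norm_star_mul_self, ← CStarRing.norm_star_mul_self, elemMat_star,
        elemMat_mul _ _ _ _ _ _ h]
      exact NonUnitalStarAlgHom.norm_apply_le (diagHom j n) (star a * a)
    exact (mul_self_le_mul_self_iff (norm_nonneg _) (norm_nonneg _)).2 h1
  · rw [elemMat_eq_zero _ _ _ _ (by simp [h]), norm_zero]
    exact norm_nonneg _

/-- The bounded sequence of matrices `a ⊗ e_{ij}`, one in each `M_n(A)`. -/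
def elemSeq (i j : ℕ) (a : A) : lp (Mat A) ∞ :=
  ⟨elemMat i j a, memℓp_infty ⟨‖a‖, by rintro _ ⟨n, rfl⟩; exact norm_elemMat_le i j a n⟩⟩

/-- The elementary tensor `a ⊗ e_{ij}`, an element of the corona `∏ M_n(A) / ⨁ M_n(A)`. -/
def elemTensor (i j : ℕ) (a : A) : Corona (Mat A) := Corona.mk (elemSeq i j a)

variable (A)

/-- The closed *-subalgebra generated by the elementary tensors `a ⊗ e_{ij}`. The finite matrices
`M_∞(A) = ⋃ M_n(A)` embed isometrically in the corona, so this is the C*-algebraic inductive limit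
of the `M_n(A)` along the upper left corner embeddings, that is, `A ⊗ K`. -/
def stabSubalgebra : NonUnitalStarSubalgebra ℂ (Corona (Mat A)) :=
  (NonUnitalStarAlgebra.adjoin ℂ
    {x | ∃ (i j : ℕ) (a : A), x = elemTensor i j a}).topologicalClosure

instance isClosed_stabSubalgebra : IsClosed (stabSubalgebra A : Set (Corona (Mat A))) :=
  NonUnitalStarSubalgebra.isClosed_topologicalClosure _

/-- The stabilization `A ⊗ K`, with `K` the compact operators on a separable infinite-dimensional
Hilbert space. -/
def Stab : Type _ := stabSubalgebra A

instance : NonUnitalCStarAlgebra (Stab A) :=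
  inferInstanceAs (NonUnitalCStarAlgebra (stabSubalgebra A))

instance : PartialOrder (Stab A) := CStarAlgebra.spectralOrder _

instance : StarOrderedRing (Stab A) := CStarAlgebra.spectralOrderedRing _

variable {A}

theorem elemTensor_mem (i j : ℕ) (a : A) : elemTensor i j a ∈ stabSubalgebra A :=
  NonUnitalStarSubalgebra.le_topologicalClosure _
    (NonUnitalStarAlgebra.subset_adjoin ℂ _ ⟨i, j, a, rfl⟩)

/-- The identification of `A` with the top left corner of `A ⊗ K`. -/
def corner : A →⋆ₙₐ[ℂ] Stab A where
  toFun a := (⟨elemTensor 0 0 a, elemTensor_mem 0 0 a⟩ : stabSubalgebra A)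
  map_smul' c a := Subtype.ext (congrArg Corona.mk
    (Subtype.ext (funext fun n => map_smul (diagHom 0 n) c a) :
      elemSeq 0 0 (c • a) = c • elemSeq 0 0 a))
  map_zero' := Subtype.ext (congrArg Corona.mk
    (Subtype.ext (funext fun n => map_zero (diagHom 0 n)) : elemSeq 0 0 (0 : A) = 0))
  map_add' a b := Subtype.ext (congrArg Corona.mk
    (Subtype.ext (funext fun n => map_add (diagHom 0 n) a b) :
      elemSeq 0 0 (a + b) = elemSeq 0 0 a + elemSeq 0 0 b))
  map_mul' a b := Subtype.ext (congrArg Corona.mk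
    (Subtype.ext (funext fun n => map_mul (diagHom 0 n) a b) :
      elemSeq 0 0 (a * b) = elemSeq 0 0 a * elemSeq 0 0 b))
  map_star' a := Subtype.ext (congrArg Corona.mk
    (Subtype.ext (funext fun n => map_star (diagHom 0 n) a) :
      elemSeq 0 0 (star a) = star (elemSeq 0 0 a)))

variable {B : Type*} [NonUnitalCStarAlgebra B] [PartialOrder B] [StarOrderedRing B]

/-- Entrywise application of a *-homomorphism, on the coronas. -/
def coronaMap (φ : A →⋆ₙₐ[ℂ] B) : Corona (Mat A) →⋆ₙₐ[ℂ] Corona (Mat B) :=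
  Corona.map fun _ => CStarMatrix.mapₙₐ φ

theorem coronaMap_elemTensor (φ : A →⋆ₙₐ[ℂ] B) (i j : ℕ) (a : A) :
    coronaMap φ (elemTensor i j a) = elemTensor i j (φ a) := by
  refine congrArg Corona.mk (Subtype.ext (funext fun n => ?_))
  ext k l
  change φ (elemMat i j a n k l) = elemMat i j (φ a) n k l
  rw [elemMat_apply, elemMat_apply]
  split_ifs <;> simp

theorem coronaMap_mem (φ : A →⋆ₙₐ[ℂ] B) {x : Corona (Mat A)} (hx : x ∈ stabSubalgebra A) :
    coronaMap φ x ∈ stabSubalgebra B := by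
  have hcont : Continuous (coronaMap φ) :=
    AddMonoidHomClass.continuous_of_bound (coronaMap φ) 1 fun x => by
      simpa using NonUnitalStarAlgHom.norm_apply_le (coronaMap φ) x
  have hle : NonUnitalStarAlgebra.adjoin ℂ
      {x | ∃ (i j : ℕ) (a : A), x = elemTensor i j a} ≤
      (stabSubalgebra B).comap (coronaMap φ) := by
    refine NonUnitalStarAlgebra.adjoin_le ?_
    rintro _ ⟨i, j, a, rfl⟩
    change coronaMap φ (elemTensor i j a) ∈ stabSubalgebra B
    rw [coronaMap_elemTensor]
    exact elemTensor_mem i j (φ a)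
  have hclosed : IsClosed ((stabSubalgebra B).comap (coronaMap φ) : Set (Corona (Mat A))) :=
    (isClosed_stabSubalgebra B).preimage hcont
  exact NonUnitalStarSubalgebra.topologicalClosure_minimal _ hle hclosed hx

/-- The *-homomorphism `φ ⊗ id : A ⊗ K → B ⊗ K` induced by `φ : A → B`. -/
def Stab.map (φ : A →⋆ₙₐ[ℂ] B) : Stab A →⋆ₙₐ[ℂ] Stab B where
  toFun x := (⟨coronaMap φ x.1, coronaMap_mem φ x.2⟩ : stabSubalgebra B)
  map_smul' c x := Subtype.ext (map_smul (coronaMap φ) c x.1)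
  map_zero' := Subtype.ext (map_zero (coronaMap φ))
  map_add' x y := Subtype.ext (map_add (coronaMap φ) x.1 y.1)
  map_mul' x y := Subtype.ext (map_mul (coronaMap φ) x.1 y.1)
  map_star' x := Subtype.ext (map_star (coronaMap φ) x.1)

end Stabilization

section CuntzSemigroup

/-- Cuntz comparison `a ≾ b` in a C*-algebra: `d_n^* b d_n → a` for some sequence `(d_n)`. -/
def CuntzLE {D : Type*} [NonUnitalCStarAlgebra D] (a b : D) : Prop :=
  ∃ d : ℕ → D, Tendsto (fun n => star (d n) * b * d n) atTop (𝓝 a)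

/-- Murray-von Neumann equivalence `a ∼ b`: `a = x^* x` and `b = x x^*` for some `x`. -/
def MvnEquiv {D : Type*} [NonUnitalCStarAlgebra D] (a b : D) : Prop :=
  ∃ x : D, a = star x * x ∧ b = x * star x

section Compare

variable {D : Type*} [NonUnitalCStarAlgebra D]

theorem cuntzLE_iff_mem_closure {a b : D} :
    CuntzLE a b ↔ a ∈ closure (Set.range fun d : D => star d * b * d) := by
  rw [mem_closure_iff_seq_limit]
  constructor
  · rintro ⟨d, hd⟩
    exact ⟨_, fun n => ⟨d n, rfl⟩, hd⟩
  · rintro ⟨x, hx, hlim⟩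
    choose d hd using hx
    exact ⟨d, by simpa only [hd] using hlim⟩

theorem CuntzLE.trans {a b c : D} (hab : CuntzLE a b) (hbc : CuntzLE b c) : CuntzLE a c := by
  rw [cuntzLE_iff_mem_closure] at hab ⊢
  obtain ⟨e, he⟩ := hbc
  refine closure_minimal ?_ isClosed_closure hab
  rintro _ ⟨d, rfl⟩
  rw [← cuntzLE_iff_mem_closure]
  refine ⟨fun n => e n * d, ?_⟩
  have h : Tendsto (fun n => star d * (star (e n) * c * e n) * d) atTop (𝓝 (star d * b * d)) :=
    (he.const_mul (star d)).mul_const d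
  simpa only [star_mul, mul_assoc] using h

theorem CuntzLE.refl [PartialOrder D] [StarOrderedRing D] (a : D) : CuntzLE a a := by
  rw [cuntzLE_iff_mem_closure]
  have hu := CStarAlgebra.increasingApproximateUnit D
  have hne := hu.neBot
  have h1 : Tendsto (fun u : D => a * u) (CStarAlgebra.approximateUnit D) (𝓝 a) :=
    hu.tendsto_mul_left a
  have h2 : Tendsto (fun u : D => u * (a * u)) (CStarAlgebra.approximateUnit D) (𝓝 a) := by
    have h3 : Tendsto (fun u : D => u * (a * u - a)) (CStarAlgebra.approximateUnit D) (𝓝 0) := by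
      rw [tendsto_zero_iff_norm_tendsto_zero]
      have h4 : Tendsto (fun u : D => ‖a * u - a‖) (CStarAlgebra.approximateUnit D) (𝓝 0) := by
        have := (h1.sub_const a).norm
        simpa using this
      refine squeeze_zero' (Eventually.of_forall fun _ => norm_nonneg _) ?_ h4
      filter_upwards [hu.eventually_norm] with u hu1
      calc ‖u * (a * u - a)‖ ≤ ‖u‖ * ‖a * u - a‖ := norm_mul_le _ _
        _ ≤ 1 * ‖a * u - a‖ := by gcongr
        _ = ‖a * u - a‖ := one_mul _
    have h5 := h3.add (hu.tendsto_mul_right a)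
    simpa [mul_sub] using h5
  refine mem_closure_of_tendsto h2 ?_
  filter_upwards [hu.eventually_star_eq] with u hus
  exact ⟨u, by simp only [hus, mul_assoc]⟩

theorem CuntzLE.map {E : Type*} [NonUnitalCStarAlgebra E] (ψ : D →⋆ₙₐ[ℂ] E) {a b : D}
    (h : CuntzLE a b) : CuntzLE (ψ a) (ψ b) := by
  obtain ⟨d, hd⟩ := h
  have hcont : Continuous ψ := AddMonoidHomClass.continuous_of_bound ψ 1 fun x => by
    simpa using NonUnitalStarAlgHom.norm_apply_le ψ x
  refine ⟨fun n => ψ (d n), ?_⟩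
  have h := (hcont.tendsto a).comp hd
  refine h.congr fun n => ?_
  simp [map_mul, map_star]

theorem map_pos_elem [PartialOrder D] [StarOrderedRing D] {E : Type*} [NonUnitalCStarAlgebra E]
    [PartialOrder E] [StarOrderedRing E] (ψ : D →⋆ₙₐ[ℂ] E) {a : D} (h : 0 ≤ a) : 0 ≤ ψ a := by
  obtain ⟨x, rfl⟩ := CStarAlgebra.nonneg_iff_eq_star_mul_self.1 h
  rw [map_mul, map_star]
  exact star_mul_self_nonneg _

end Compare

variable (A : Type*) [NonUnitalCStarAlgebra A] [PartialOrder A] [StarOrderedRing A]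

/-- The positive elements of `A ⊗ K`, preordered by Cuntz comparison. -/
@[ext]
structure StabPos where
  val : Stab A
  nonneg : 0 ≤ val

instance : Preorder (StabPos A) where
  le a b := CuntzLE a.val b.val
  le_refl a := CuntzLE.refl a.val
  le_trans _ _ _ := CuntzLE.trans

/-- The Cuntz semigroup `Cu(A)` as an ordered set: the positive elements of `A ⊗ K` modulo Cuntz
equivalence, ordered by Cuntz comparison. -/
def Cu : Type _ := Antisymmetrization (StabPos A) (· ≤ ·)

instance : PartialOrder (Cu A) :=
  inferInstanceAs (PartialOrder (Antisymmetrization (StabPos A) (· ≤ ·)))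

variable {A}

/-- The Cuntz class `[a]` of a positive element of `A ⊗ K`. -/
def Cu.mk (a : Stab A) (ha : 0 ≤ a) : Cu A :=
  toAntisymmetrization (α := StabPos A) (· ≤ ·) ⟨a, ha⟩

theorem Cu.mk_le_mk {a b : Stab A} (ha : 0 ≤ a) (hb : 0 ≤ b) :
    Cu.mk a ha ≤ Cu.mk b hb ↔ CuntzLE a b := Iff.rfl

theorem Cu.mk_eq_mk {a b : Stab A} (ha : 0 ≤ a) (hb : 0 ≤ b) :
    Cu.mk a ha = Cu.mk b hb ↔ CuntzLE a b ∧ CuntzLE b a := by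
  rw [le_antisymm_iff, Cu.mk_le_mk, Cu.mk_le_mk]

theorem Cu.exists_rep (x : Cu A) : ∃ (a : Stab A) (ha : 0 ≤ a), x = Cu.mk a ha := by
  induction x using Quotient.inductionOn' with
  | h a => exact ⟨a.val, a.nonneg, rfl⟩

/-- The Cuntz class `[a]` of a positive element of `A`. -/
def Cu.ofElem (a : A) (ha : 0 ≤ a) : Cu A := Cu.mk (corner a) (map_pos_elem corner ha)

instance : Zero (Cu A) := ⟨Cu.mk 0 le_rfl⟩

/-- The addition of `Cu(A)`, as the relation `x + y = z`: one has `z = [a' + b']` for some mutually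
orthogonal `a'` and `b'` that are Murray-von Neumann equivalent to representatives `a` of `x` and
`b` of `y`. (Such a `z` always exists and is unique.) -/
def Cu.IsSum (x y z : Cu A) : Prop :=
  ∃ (a b a' b' : Stab A) (ha : 0 ≤ a) (hb : 0 ≤ b) (ha' : 0 ≤ a') (hb' : 0 ≤ b'),
    x = Cu.mk a ha ∧ y = Cu.mk b hb ∧ MvnEquiv a a' ∧ MvnEquiv b b' ∧ a' * b' = 0 ∧
      z = Cu.mk (a' + b') (add_nonneg ha' hb')

variable {B : Type*} [NonUnitalCStarAlgebra B] [PartialOrder B] [StarOrderedRing B]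

/-- The map `a ↦ (φ ⊗ id)(a)` on positive elements. -/
def StabPos.map (φ : A →⋆ₙₐ[ℂ] B) : StabPos A →o StabPos B where
  toFun a := ⟨Stab.map φ a.val, map_pos_elem _ a.nonneg⟩
  monotone' _ _ h := CuntzLE.map (Stab.map φ) h

/-- The map `Cu(φ) : Cu(A) → Cu(B)`, `[a] ↦ [(φ ⊗ id)(a)]`. -/
def Cu.map (φ : A →⋆ₙₐ[ℂ] B) : Cu A → Cu B := (StabPos.map φ).antisymmetrization

theorem Cu.map_mk (φ : A →⋆ₙₐ[ℂ] B) (a : Stab A) (ha : 0 ≤ a) :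
    Cu.map φ (Cu.mk a ha) = Cu.mk (Stab.map φ a) (map_pos_elem _ ha) := rfl

theorem Cu.map_zero (φ : A →⋆ₙₐ[ℂ] B) : Cu.map φ 0 = 0 :=
  congrArg (toAntisymmetrization (α := StabPos B) (· ≤ ·))
    (StabPos.ext (_root_.map_zero (Stab.map φ)))

theorem Cu.zero_le (x : Cu A) : 0 ≤ x := by
  induction x using Quotient.inductionOn' with
  | h a => exact (⟨fun _ => 0, by simp⟩ : CuntzLE 0 a.val)

/-- The far below relation `x ≪ y`: whenever `y ≤ sup u_n` with `(u_n)` increasing, already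
`x ≤ u_k` for some `k`. -/
def FarBelow {S : Type*} [PartialOrder S] (x y : S) : Prop :=
  ∀ u : ℕ → S, Monotone u → ∀ s, IsLUB (Set.range u) s → y ≤ s → ∃ k, x ≤ u k

/-- Morphisms of the category `Cu` between Cuntz semigroups: order preserving semigroup maps that
preserve `0`, suprema of increasing sequences, and the far below relation. -/
structure IsCuMorphism (α : Cu A → Cu B) : Prop where
  monotone : Monotone α
  map_zero : α 0 = 0
  map_add : ∀ x y z, Cu.IsSum x y z → Cu.IsSum (α x) (α y) (α z)
  map_sup : ∀ u : ℕ → Cu A, Monotone u → ∀ s, IsLUB (Set.range u) s →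
    IsLUB (Set.range fun n => α (u n)) (α s)
  map_farBelow : ∀ x y, FarBelow x y → FarBelow (α x) (α y)

end CuntzSemigroup

section Cone

/-- The C*-algebra `C_0(0,1]`. -/
abbrev Cone : Type := C₀(Set.Ioc (0 : ℝ) 1, ℂ)

instance : PartialOrder Cone := CStarAlgebra.spectralOrder _

instance : StarOrderedRing Cone := CStarAlgebra.spectralOrderedRing _

theorem tendsto_coe_cocompact :
    Tendsto (fun x : Set.Ioc (0 : ℝ) 1 => (x : ℝ)) (cocompact _) (𝓝 0) := by
  rw [Metric.tendsto_nhds]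
  intro ε hε
  rw [Filter.eventually_iff, mem_cocompact]
  have hK : IsCompact ((fun x : Set.Ioc (0 : ℝ) 1 => (x : ℝ)) ⁻¹' Set.Icc ε 1) := by
    refine Subtype.isCompact_iff.2 ?_
    rw [Subtype.image_preimage_coe, Set.inter_eq_self_of_subset_right]
    · exact isCompact_Icc
    · exact fun x hx => ⟨hε.trans_le hx.1, hx.2⟩
  refine ⟨_, hK, fun x hx => ?_⟩
  simp only [Set.mem_compl_iff, Set.mem_preimage, Set.mem_Icc, not_and, Set.mem_ofPred_eq,
    Real.dist_eq, sub_zero] at hx ⊢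
  rw [abs_of_pos x.2.1]
  by_contra hlt
  exact hx (not_lt.1 hlt) x.2.2

/-- The element of `C_0(0,1]` given by a continuous real function on `ℝ` vanishing at `0`. -/
def coneFun (f : ℝ → ℝ) (hf : Continuous f) (h0 : f 0 = 0) : Cone where
  toFun x := (f x : ℂ)
  continuous_toFun := by fun_prop
  zero_at_infty' := by
    have h : Tendsto (fun y : ℝ => (f y : ℂ)) (𝓝 0) (𝓝 0) := by
      have hc : Continuous fun y : ℝ => (f y : ℂ) := by fun_prop
      simpa [h0] using hc.tendsto 0
    exact h.comp tendsto_coe_cocompact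

theorem coneFun_nonneg (f : ℝ → ℝ) (hf : Continuous f) (h0 : f 0 = 0) (hpos : ∀ x, 0 ≤ f x) :
    0 ≤ coneFun f hf h0 := by
  have h : coneFun f hf h0 =
      star (coneFun (fun x => √(f x)) (by fun_prop) (by simp [h0])) *
        coneFun (fun x => √(f x)) (by fun_prop) (by simp [h0]) := by
    ext x
    change (f x : ℂ) = star ((√(f x) : ℝ) : ℂ) * ((√(f x) : ℝ) : ℂ)
    rw [Complex.star_def, Complex.conj_ofReal, ← Complex.ofReal_mul, Real.mul_self_sqrt (hpos _)]
  rw [h]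
  exact star_mul_self_nonneg _

/-- The function `e_t(x) = max (x - t) 0` in `C_0(0,1]`, for `t ≥ 0`. -/
def cutFun (t : NNReal) : Cone :=
  coneFun (fun x => max (x - t) 0) (by fun_prop) (by simp)

theorem cutFun_nonneg (t : NNReal) : 0 ≤ cutFun t :=
  coneFun_nonneg _ _ _ fun _ => le_max_right _ _

/-- The identity function `id(x) = x` in `C_0(0,1]`. -/
def idFun : Cone := coneFun (fun x => x) continuous_id rfl

theorem idFun_eq : idFun = cutFun 0 := by
  ext x
  change ((x : ℝ) : ℂ) = ((max ((x : ℝ) - (0 : NNReal)) 0 : ℝ) : ℂ)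
  rw [NNReal.coe_zero, sub_zero, max_eq_left x.2.1.le]

theorem idFun_nonneg : 0 ≤ idFun := idFun_eq ▸ cutFun_nonneg 0

theorem cutFun_eq_zero {t : NNReal} (ht : 1 ≤ t) : cutFun t = 0 := by
  ext x
  change ((max ((x : ℝ) - t) 0 : ℝ) : ℂ) = 0
  have h : (x : ℝ) - t ≤ 0 := by
    have h1 : (1 : ℝ) ≤ t := by exact_mod_cast ht
    linarith [x.2.2]
  rw [max_eq_right h, Complex.ofReal_zero]

/-- The class `[e_t]` in `Cu(C_0(0,1])`. -/
def cutClass (t : NNReal) : Cu Cone := Cu.ofElem (cutFun t) (cutFun_nonneg t)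

theorem cutClass_eq_zero {t : NNReal} (ht : 1 ≤ t) : cutClass t = 0 :=
  congrArg (toAntisymmetrization (α := StabPos Cone) (· ≤ ·))
    (StabPos.ext ((congrArg corner (cutFun_eq_zero ht)).trans (map_zero corner)))

variable {A : Type*} [NonUnitalCStarAlgebra A] [PartialOrder A] [StarOrderedRing A]

/-- The set of `r ≥ 0` with `α([e_{t+r}]) ≤ β([e_t])` and `β([e_{t+r}]) ≤ α([e_t])` for all
`t ≥ 0`. -/
def dWSet (α β : Cu Cone → Cu A) : Set NNReal :=
  {r | ∀ t : NNReal, α (cutClass (t + r)) ≤ β (cutClass t) ∧ β (cutClass (t + r)) ≤ α (cutClass t)}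

/-- The pseudometric `d_W` on maps from `Cu(C_0(0,1])` to `Cu(A)`. -/
def dW (α β : Cu Cone → Cu A) : NNReal := sInf (dWSet α β)

/-- For maps preserving `0` the infimum is taken over a nonempty set. -/
theorem dWSet_nonempty {α β : Cu Cone → Cu A} (hα : α 0 = 0) (hβ : β 0 = 0) :
    (dWSet α β).Nonempty := by
  refine ⟨1, fun t => ?_⟩
  rw [cutClass_eq_zero le_add_self, hα, hβ]
  exact ⟨Cu.zero_le _, Cu.zero_le _⟩

/-- A positive element `h` of `A` is strictly positive if the hereditary subalgebra that it
generates, the closure of `h A h`, is all of `A`. -/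
def StrictlyPositive (h : A) : Prop := 0 ≤ h ∧ Dense (Set.range fun a : A => h * a * h)

end Cone

end

end CuntzSemigroup

namespace CuntzSemigroup

noncomputable section

open Filter Topology
open scoped ENNReal ZeroAtInfty ComplexOrder

/-! ### Rules for Cuntz comparison and for the real functional calculus -/

section Comparison

variable {D : Type*} [NonUnitalCStarAlgebra D]

/-! A *-homomorphism out of C_0(0,1] amounts to a positive contraction b, the image of id, and it
sends e_t to (b - t)_+. Put x_i = α([e_{i/n}]). It suffices to find b in A with x_{i+1} ≤ [(b -
i/n)_+] ≤ x_i for every i: rounding an arbitrary t to the grid then gives d_W ≤ 2/n.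

The x_i decrease rapidly, since [e_t] ≪ [e_s] for s < t (`cutClass_farBelow`) and α preserves ≪. The
relation in the cone comes from point evaluations. A positive element of the stabilized cone that
vanishes nowhere on [t,1] Cuntz dominates e_t (`cuntzLE_corner_cutFun`). If no term of an increasing
sequence dominated e_t, compactness would give a point x ≥ t at which all terms vanish. The terms
would then have a common upper bound vanishing at x, so their supremum could not dominate e_s,
because e_s(x) > 0.

Starting from h, `exists_interpolation` (Rørdam's lemma plus a perturbation) inserts an element of A
between consecutive x_i, each living where a function of the previous one is a unit. Functions g_i
of these elements are positive contractions with g_i g_{i+1} = g_{i+1} and x_{i+1} ≤ [g_i] ≤ x_i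
(`exists_contractions`). The element b is the staircase (1/n) Σ_{i<n} g_i: cutting down by 1/n
removes exactly its first step (`cut_smul_add`), so (b - i/n)_+ is the tail starting at i, which is
Cuntz equivalent to g_i (`exists_interlaced`). -/

theorem CuntzLE.of_eq {a b d : D} (h : star d * b * d = a) : CuntzLE a b :=
  ⟨fun _ => d, by simp [h]⟩

theorem CuntzLE.zero_left (b : D) : CuntzLE 0 b := .of_eq (d := 0) (by simp)

theorem CuntzLE.eq_zero {a : D} (h : CuntzLE a 0) : a = 0 := by
  obtain ⟨d, hd⟩ := h
  simp only [mul_zero, zero_mul] at hd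
  exact tendsto_nhds_unique hd tendsto_const_nhds |>.trans rfl

theorem CuntzLE.of_closure {a b : D} (h : ∀ ε > 0, ∃ c, ‖a - c‖ ≤ ε ∧ CuntzLE c b) :
    CuntzLE a b := by
  rw [cuntzLE_iff_mem_closure, ← closure_closure, Metric.mem_closure_iff]
  intro ε hε
  obtain ⟨c, hc, hcb⟩ := h (ε / 2) (half_pos hε)
  refine ⟨c, cuntzLE_iff_mem_closure.1 hcb, ?_⟩
  rw [dist_eq_norm]
  linarith

theorem CuntzLE.smul_left {a b : D} (h : CuntzLE a b) {r : ℝ} (hr : 0 ≤ r) :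
    CuntzLE (r • a) b := by
  obtain ⟨d, hd⟩ := h
  refine ⟨fun n => √r • d n, ?_⟩
  have h1 : ∀ n, star (√r • d n) * b * (√r • d n) = r • (star (d n) * b * d n) := fun n => by
    rw [star_smul, star_trivial, smul_mul_assoc, smul_mul_assoc, mul_smul_comm, smul_smul,
      Real.mul_self_sqrt hr]
  simpa only [h1] using hd.const_smul r

theorem fc_mul {f g : ℝ → ℝ} (hf : Continuous f) (hg : Continuous g) (hf0 : f 0 = 0)
    (hg0 : g 0 = 0) (a : D) : cfcₙ f a * cfcₙ g a = cfcₙ (fun t => f t * g t) a :=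
  (cfcₙ_mul f g a hf.continuousOn hf0 hg.continuousOn hg0).symm

theorem fc_sub {f g : ℝ → ℝ} (hf : Continuous f) (hg : Continuous g) (hf0 : f 0 = 0)
    (hg0 : g 0 = 0) (a : D) : cfcₙ f a - cfcₙ g a = cfcₙ (fun t => f t - g t) a :=
  (cfcₙ_sub f g a hf.continuousOn hf0 hg.continuousOn hg0).symm

theorem fc_smul {f : ℝ → ℝ} (hf : Continuous f) (hf0 : f 0 = 0) (r : ℝ) (a : D) :
    r • cfcₙ f a = cfcₙ (fun t => r * f t) a :=
  (cfcₙ_const_mul r f a hf.continuousOn hf0).symm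

theorem fc_isSelfAdjoint (f : ℝ → ℝ) (a : D) : IsSelfAdjoint (cfcₙ f a) :=
  cfcₙ_predicate f a

theorem fc_mul_self {f : ℝ → ℝ} (hf : Continuous f) (hf0 : f 0 = 0) {a : D}
    (ha : IsSelfAdjoint a) : cfcₙ f a * a = cfcₙ (fun t => f t * t) a := by
  rw [← fc_mul hf continuous_id' hf0 rfl, cfcₙ_id' ℝ a]

theorem fc_self_sub {f : ℝ → ℝ} (hf : Continuous f) (hf0 : f 0 = 0) {a : D}
    (ha : IsSelfAdjoint a) : a - cfcₙ f a = cfcₙ (fun t => t - f t) a := by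
  rw [← fc_sub continuous_id' hf rfl hf0, cfcₙ_id' ℝ a]

end Comparison

/-! ### Comparison of positive elements: cut-downs, perturbation, Rørdam's lemma -/

section Ordered

variable {D : Type*} [NonUnitalCStarAlgebra D] [PartialOrder D] [StarOrderedRing D]

/-- Both sides are expansions of (1 - e) x (1 - e). In the unitization this conjugation preserves
order, and the norm is monotone on positive elements. -/
theorem norm_conjugate_one_sub_le {a b e : D} (ha : 0 ≤ a) (hab : a ≤ b) (he : IsSelfAdjoint e) :
    ‖a - e * a - (a - e * a) * e‖ ≤ ‖b - e * b - (b - e * b) * e‖ := by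
  have key : ∀ x : D, ((x - e * x - (x - e * x) * e : D) : Unitization ℂ D) =
      star (1 - (e : Unitization ℂ D)) * x * (1 - e) := by
    intro x
    have : star (e : Unitization ℂ D) = e := by rw [← Unitization.inr_star, he.star_eq]
    simp only [Unitization.inr_sub, Unitization.inr_mul, star_sub, star_one, this]
    noncomm_ring
  rw [← Unitization.norm_inr (𝕜 := ℂ), ← Unitization.norm_inr (𝕜 := ℂ) (_ - _ - _), key, key]
  refine CStarAlgebra.norm_le_norm_of_nonneg_of_le ?_ ?_
  · exact star_left_conjugate_nonneg (Unitization.inr_nonneg_iff.2 ha) _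
  · refine star_left_conjugate_le_conjugate ?_ _
    exact (Unitization.inr_le_iff a b ha.isSelfAdjoint (ha.trans hab).isSelfAdjoint).2 hab

theorem fc_comp {f g : ℝ → ℝ} (hf : Continuous f) (hg : Continuous g) (hf0 : f 0 = 0)
    (hg0 : g 0 = 0) {a : D} (ha : 0 ≤ a) : cfcₙ g (cfcₙ f a) = cfcₙ (fun t => g (f t)) a :=
  (cfcₙ_comp' g f a hg.continuousOn hg0 hf.continuousOn hf0 ha.isSelfAdjoint).symm

theorem fc_id {a : D} (ha : 0 ≤ a) : cfcₙ (fun t : ℝ => t) a = a :=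
  cfcₙ_id' ℝ a ha.isSelfAdjoint

theorem fc_congr {f g : ℝ → ℝ} {a : D} (ha : 0 ≤ a) (h : ∀ t, 0 ≤ t → f t = g t) :
    cfcₙ f a = cfcₙ g a :=
  cfcₙ_congr fun t ht => h t (quasispectrum_nonneg_of_nonneg a ha t ht)

theorem fc_nonneg {f : ℝ → ℝ} {a : D} (ha : 0 ≤ a) (h : ∀ t, 0 ≤ t → 0 ≤ f t) :
    0 ≤ cfcₙ f a :=
  cfcₙ_nonneg fun t ht => h t (quasispectrum_nonneg_of_nonneg a ha t ht)

theorem fc_mono {f g : ℝ → ℝ} (hf : Continuous f) (hg : Continuous g) (hf0 : f 0 = 0)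
    (hg0 : g 0 = 0) {a : D} (ha : 0 ≤ a) (h : ∀ t, 0 ≤ t → f t ≤ g t) :
    cfcₙ f a ≤ cfcₙ g a :=
  cfcₙ_mono (fun t ht => h t (quasispectrum_nonneg_of_nonneg a ha t ht))
    hf.continuousOn hg.continuousOn hf0 hg0

theorem norm_fc_le {f : ℝ → ℝ} {a : D} (ha : 0 ≤ a) {C : ℝ} (h : ∀ t, 0 ≤ t → |f t| ≤ C) :
    ‖cfcₙ f a‖ ≤ C :=
  norm_cfcₙ_le fun t ht => h t (quasispectrum_nonneg_of_nonneg a ha t ht)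

theorem norm_sub_fc_le {f g : ℝ → ℝ} (hf : Continuous f) (hg : Continuous g) (hf0 : f 0 = 0)
    (hg0 : g 0 = 0) {a : D} (ha : 0 ≤ a) {C : ℝ} (h : ∀ t, 0 ≤ t → |f t - g t| ≤ C) :
    ‖cfcₙ f a - cfcₙ g a‖ ≤ C := by
  rw [fc_sub hf hg hf0 hg0]
  exact norm_fc_le ha h

theorem continuous_div_max {δ : ℝ} (hδ : 0 < δ) {f : ℝ → ℝ} (hf : Continuous f) :
    Continuous fun t : ℝ => f t / max δ t :=
  hf.div (by fun_prop) fun _ => (lt_max_of_lt_left hδ).ne'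

/-- The function involved is t (1 - t / max δ t)², which vanishes for t ≥ δ and is at most t ≤ δ
below. -/
theorem norm_conjugate_one_sub_fc_le {b : D} (hb : 0 ≤ b) {δ : ℝ} (hδ : 0 < δ) :
    ‖b - cfcₙ (fun t : ℝ => t / max δ t) b * b -
      (b - cfcₙ (fun t : ℝ => t / max δ t) b * b) * cfcₙ (fun t : ℝ => t / max δ t) b‖ ≤ δ := by
  have hc : Continuous fun t : ℝ => t / max δ t := continuous_div_max hδ continuous_id
  have h1 : b - cfcₙ (fun t : ℝ => t / max δ t) b * b =
      cfcₙ (fun t : ℝ => t - t / max δ t * t) b := by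
    rw [fc_mul_self hc (by simp) hb.isSelfAdjoint,
      fc_self_sub (by fun_prop) (by simp) hb.isSelfAdjoint]
  rw [h1, fc_mul (by fun_prop) hc (by simp) (by simp),
    fc_sub (by fun_prop) (by fun_prop) (by simp) (by simp)]
  refine norm_fc_le hb fun t ht0 => ?_
  rcases le_total δ t with h | h
  · rw [max_eq_right h, div_self (hδ.trans_le h).ne']
    simpa using hδ.le
  · rw [max_eq_left h, abs_le]
    have h3 : 0 ≤ t / δ := by positivity
    have h4 : t / δ ≤ 1 := (div_le_one hδ).2 h
    have h5 : t - t / δ * t - (t - t / δ * t) * (t / δ) = t * (1 - t / δ) ^ 2 := by ring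
    rw [h5]
    constructor
    · have : 0 ≤ t * (1 - t / δ) ^ 2 := by positivity
      linarith
    · have : (1 - t / δ) ^ 2 ≤ 1 := by nlinarith
      nlinarith

/-- Cuntz comparison is coarser than the order on positive elements. -/
theorem CuntzLE.of_le {a b : D} (ha : 0 ≤ a) (hab : a ≤ b) : CuntzLE a b := by
  have hb := ha.trans hab
  have hbs := hb.isSelfAdjoint
  refine .of_closure fun ε hε => ?_
  set s := CFC.sqrt a with hs
  have hss : s * s = a := CFC.sqrt_mul_sqrt_self a
  have hsa : star s = s := (CFC.sqrt_nonneg a).isSelfAdjoint.star_eq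
  set η : ℝ := ε / (2 * ‖s‖ + 1) with hη
  have hη0 : 0 < η := by positivity
  -- The estimate below bounds ‖s - e s‖² by δ, whence the square; η is chosen so that the final
  -- error η (2‖s‖ + 1) equals ε.
  set δ : ℝ := η ^ 2
  have hδ : 0 < δ := by positivity
  have hc : Continuous fun t : ℝ => t / max δ t := continuous_div_max hδ continuous_id
  have hk : Continuous fun t : ℝ => √t / max δ t := continuous_div_max hδ Real.continuous_sqrt
  set e := cfcₙ (fun t : ℝ => t / max δ t) b with he
  set k := cfcₙ (fun t : ℝ => √t / max δ t) b with hk'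
  have hes : IsSelfAdjoint e := cfcₙ_predicate _ _
  have hks : IsSelfAdjoint k := cfcₙ_predicate _ _
  -- With this identity, (k s)^* b (k s) = s e² s, which is close to s² = a once e s is close to s.
  have hkbk : k * b * k = e * e := by
    have hb1 : k * b = cfcₙ (fun t : ℝ => √t / max δ t * t) b := by
      rw [hk', fc_mul_self hk (by simp) hbs]
    rw [hb1, hk', he, fc_mul (by fun_prop) hk (by simp) (by simp), fc_mul hc hc (by simp) (by simp)]
    refine fc_congr hb fun t ht0 => ?_
    have : √t * √t = t := Real.mul_self_sqrt ht0
    calc √t / max δ t * t * (√t / max δ t) = (√t * √t) * t / (max δ t * max δ t) := by ring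
      _ = _ := by rw [this]; ring
  have hnorm : ‖s - e * s‖ ≤ η := by
    have h1 : ‖s - e * s‖ * ‖s - e * s‖ = ‖a - e * a - (a - e * a) * e‖ := by
      rw [← CStarRing.norm_self_mul_star]
      congr 1
      rw [star_sub, star_mul, hsa, hes.star_eq, ← hss]
      noncomm_ring
    have h2 : ‖s - e * s‖ * ‖s - e * s‖ ≤ δ := by
      rw [h1]
      exact (norm_conjugate_one_sub_le ha hab hes).trans (norm_conjugate_one_sub_fc_le hb hδ)
    exact abs_le_of_sq_le_sq' (by rw [sq]; exact h2) hη0.le |>.2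
  have he1 : ‖e‖ ≤ 1 := by
    refine norm_fc_le hb fun t ht0 => ?_
    rw [abs_of_nonneg (by positivity)]
    exact div_le_one_of_le₀ (le_max_right _ _) (by positivity)
  refine ⟨star (k * s) * b * (k * s), ?_, .of_eq rfl⟩
  have h3 : a - star (k * s) * b * (k * s) = s * (s - e * s) + star (s - e * s) * (e * s) := by
    rw [star_mul, hsa, hks.star_eq, star_sub, star_mul, hsa, hes.star_eq]
    have : s * k * b * (k * s) = s * (k * b * k) * s := by noncomm_ring
    rw [this, hkbk, ← hss]
    noncomm_ring
  rw [h3]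
  calc ‖s * (s - e * s) + star (s - e * s) * (e * s)‖
      ≤ ‖s‖ * ‖s - e * s‖ + ‖star (s - e * s)‖ * (‖e‖ * ‖s‖) := by
        refine (norm_add_le _ _).trans (add_le_add (norm_mul_le _ _) ?_)
        exact (norm_mul_le _ _).trans (by gcongr; exact norm_mul_le _ _)
    _ ≤ ‖s‖ * η + η * (1 * ‖s‖) := by rw [norm_star]; gcongr
    _ = η * (2 * ‖s‖) := by ring
    _ ≤ η * (2 * ‖s‖ + 1) := by gcongr; linarith
    _ = ε := by rw [hη]; field_simp

theorem CuntzLE.of_le_smul {a b : D} (ha : 0 ≤ a) {r : ℝ} (hr : 0 ≤ r) (h : a ≤ r • b) :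
    CuntzLE a b :=
  (CuntzLE.of_le ha h).trans ((CuntzLE.refl b).smul_left hr)

/-- The hypothesis gives (f - ε)_+ ≤ C g, hence (f - ε)_+(a) ≾ g(a), and (f - ε)_+(a) is within ε of
f(a). The constant C may blow up as ε tends to 0, so only the zero set of g matters. -/
theorem CuntzLE.fc_of_le {f g : ℝ → ℝ} (hf : Continuous f) (hg : Continuous g) (hf0 : f 0 = 0)
    (hg0 : g 0 = 0) (hfp : ∀ t, 0 ≤ t → 0 ≤ f t) {a : D} (ha : 0 ≤ a)
    (h : ∀ ε > 0, ∃ C ≥ 0, ∀ t, 0 ≤ t → f t ≤ C * g t + ε)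
    (hgp : ∀ t, 0 ≤ t → 0 ≤ g t) :
    CuntzLE (cfcₙ f a) (cfcₙ g a) := by
  refine .of_closure fun ε hε => ?_
  obtain ⟨C, hC, hfg⟩ := h ε hε
  refine ⟨cfcₙ (fun t => max (f t - ε) 0) a, ?_, ?_⟩
  · refine norm_sub_fc_le hf (by fun_prop) hf0 (by simp [hf0, hε.le]) ha fun t ht => ?_
    have := hfp t ht
    rcases max_cases (f t - ε) 0 with h | h <;> rw [h.1, abs_le] <;> constructor <;> linarith
  · refine .of_le_smul (r := C) (fc_nonneg ha fun t _ => le_max_right _ _) hC ?_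
    rw [fc_smul hg hg0]
    refine fc_mono (by fun_prop) (by fun_prop) (by simp [hf0, hε.le]) (by simp [hg0]) ha
      fun t ht => max_le ?_ (mul_nonneg hC (hgp t ht))
    linarith [hfg t ht]

/-- The cut-down `(a - t)_+`. -/
def cut (a : D) (t : ℝ) : D := cfcₙ (fun x : ℝ => max (x - t) 0) a

theorem cut_nonneg {a : D} (ha : 0 ≤ a) (t : ℝ) : 0 ≤ cut a t :=
  fc_nonneg ha fun _ _ => le_max_right _ _

theorem cut_cut {a : D} (ha : 0 ≤ a) {s t : ℝ} (hs : 0 ≤ s) (ht : 0 ≤ t) :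
    cut (cut a s) t = cut a (s + t) := by
  rw [cut, cut, fc_comp (by fun_prop) (by fun_prop) (by simp [hs]) (by simp [ht]) ha]
  refine fc_congr ha fun x _ => ?_
  rcases le_total (x - s) 0 with h | h
  · rw [max_eq_right h, max_eq_right (by linarith), max_eq_right (by linarith)]
  · rw [max_eq_left h, sub_sub]

theorem cut_zero {a : D} (ha : 0 ≤ a) : cut a 0 = a := by
  conv_rhs => rw [← fc_id ha]
  exact fc_congr ha fun x hx => by simp [hx]

theorem norm_sub_cut_le {a : D} (ha : 0 ≤ a) {t : ℝ} (ht : 0 ≤ t) : ‖a - cut a t‖ ≤ t := by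
  rw [cut, fc_self_sub (by fun_prop) (by simp [ht]) ha.isSelfAdjoint]
  refine norm_fc_le ha fun x hx => ?_
  rcases max_cases (x - t) 0 with h | h <;> rw [h.1, abs_le] <;> constructor <;> linarith

theorem CuntzLE.cut_cut {a : D} (ha : 0 ≤ a) {s t : ℝ} (hs : 0 ≤ s) (hst : s ≤ t) :
    CuntzLE (cut a t) (cut a s) := by
  refine .fc_of_le (by fun_prop) (by fun_prop) (by simp [hs.trans hst]) (by simp [hs])
    (fun _ _ => le_max_right _ _) ha (fun ε hε => ⟨1, zero_le_one, fun x _ => ?_⟩)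
    (fun _ _ => le_max_right _ _)
  rw [one_mul]
  have : max (x - t) 0 ≤ max (x - s) 0 := max_le_max (by linarith) le_rfl
  linarith

theorem CuntzLE.cut_self {a : D} (ha : 0 ≤ a) {t : ℝ} (ht : 0 ≤ t) : CuntzLE (cut a t) a := by
  simpa [cut_zero ha] using CuntzLE.cut_cut ha le_rfl ht

theorem CuntzLE.of_cut {a b : D} (ha : 0 ≤ a) (h : ∀ ε > 0, CuntzLE (cut a ε) b) :
    CuntzLE a b :=
  .of_closure fun ε hε => ⟨_, norm_sub_cut_le ha hε.le, h ε hε⟩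

theorem CuntzLE.mul_self {a : D} (ha : 0 ≤ a) : CuntzLE a (a * a) := by
  have h := CuntzLE.fc_of_le (f := fun t => t) (g := fun t => t * t) (by fun_prop) (by fun_prop)
    rfl (by simp) (fun _ h => h) ha (fun ε hε => ⟨1 / ε, by positivity, fun t ht => ?_⟩)
    (fun t _ => mul_self_nonneg t)
  · rwa [← fc_mul continuous_id' continuous_id' rfl rfl, fc_id ha] at h
  · have h1 : 0 ≤ (t - ε) ^ 2 + ε * t := by positivity
    have h2 : 1 / ε * (t * t) + ε - t = ((t - ε) ^ 2 + ε * t) / ε := by field_simp; ring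
    have h3 : 0 ≤ ((t - ε) ^ 2 + ε * t) / ε := by positivity
    linarith

/-- From x x^* ≾ (x x^*)² = x (x^* x) x^*. -/
theorem CuntzLE.mul_star_self {x : D} : CuntzLE (x * star x) (star x * x) := by
  refine (CuntzLE.mul_self (mul_star_self_nonneg x)).trans (.of_eq (d := star x) ?_)
  rw [star_star]
  noncomm_ring

theorem CuntzLE.star_mul_self {x : D} : CuntzLE (star x * x) (x * star x) := by
  simpa using CuntzLE.mul_star_self (x := star x)

/-- Perturbation: if `‖a - c‖ ≤ ε` then `(a - ε)_+` is Cuntz below `c`. -/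
theorem CuntzLE.cut_of_norm_le {a c : D} (ha : 0 ≤ a) (hc : 0 ≤ c) {ε : ℝ} (hε : 0 < ε)
    (h : ‖a - c‖ ≤ ε) : CuntzLE (cut a ε) c := by
  -- F has the same zeros on t ≥ 0 as (t - ε)_+. Conjugating by e = F(a) therefore leaves g = F²(t -
  -- ε) applied to a, which is positive and still dominates (a - ε)_+.
  set F : ℝ → ℝ := fun t => min 1 (max (t - ε) 0) with hF
  have hFc : Continuous F := by fun_prop
  have hF0 : F 0 = 0 := by simp [hF, hε.le]
  have hFn : ∀ t, 0 ≤ F t := fun t => le_min zero_le_one (le_max_right _ _)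
  set e := cfcₙ F a with he
  have hes : star e = e := (fc_isSelfAdjoint F a).star_eq
  set g := cfcₙ (fun t : ℝ => F t * t * F t - ε * (F t * F t)) a with hg
  have hge : e * a * e - ε • (e * e) = g := by
    have h1 : e * a = cfcₙ (fun t => F t * t) a := fc_mul_self hFc hF0 ha.isSelfAdjoint
    rw [h1, he, fc_mul (by fun_prop) hFc (by simp) hF0, fc_mul hFc hFc hF0 hF0,
      fc_smul (by fun_prop) (by simp [hF0]), fc_sub (by fun_prop) (by fun_prop) (by simp)
      (by simp [hF0])]
  have hgF : ∀ t, F t * t * F t - ε * (F t * F t) = F t ^ 2 * max (t - ε) 0 := by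
    intro t
    rcases le_total (t - ε) 0 with h | h
    · have : F t = 0 := by simp [hF, h]
      simp [this]
    · rw [max_eq_left h]; ring
  -- From ‖a - c‖ ≤ ε one gets e (a - c) e ≤ ε e².
  have hle : g ≤ star e * c * e := by
    rw [← hge, hes, sub_le_iff_le_add, ← sub_le_iff_le_add']
    have h1 := CStarAlgebra.star_left_conjugate_le_norm_smul (a := e) (b := a - c)
      (ha.isSelfAdjoint.sub hc.isSelfAdjoint)
    rw [hes, mul_sub, sub_mul] at h1
    refine h1.trans (smul_le_smul_of_nonneg_right h ?_)
    simpa [hes] using star_mul_self_nonneg e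
  have hgn : 0 ≤ g := fc_nonneg ha fun t _ => by
    rw [hgF]; positivity
  refine .trans ?_ ((CuntzLE.of_le hgn hle).trans (.of_eq rfl))
  refine .fc_of_le (by fun_prop) (by fun_prop) (by simp [hε.le]) (by simp [hF0])
    (fun _ _ => le_max_right _ _) ha (fun δ hδ => ⟨1 / min 1 δ ^ 2, by positivity, fun t _ => ?_⟩)
    (fun t _ => by rw [hgF]; positivity)
  rw [hgF]
  have hm : 0 < min 1 δ := by positivity
  rcases le_total (max (t - ε) 0) δ with h | h
  · have : 0 ≤ 1 / min 1 δ ^ 2 * (F t ^ 2 * max (t - ε) 0) := by positivity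
    linarith
  · have h1 : min 1 δ ≤ F t := min_le_min le_rfl h
    have h2 : 1 ≤ F t ^ 2 / min 1 δ ^ 2 := by
      rw [one_le_div (by positivity)]
      gcongr
    have h3 : 1 / min 1 δ ^ 2 * (F t ^ 2 * max (t - ε) 0) =
        F t ^ 2 / min 1 δ ^ 2 * max (t - ε) 0 := by ring
    have h4 : 0 ≤ max (t - ε) 0 := le_max_right _ _
    nlinarith

/-- Rørdam's lemma. -/
theorem CuntzLE.exists_cut {a b : D} (ha : 0 ≤ a) (hb : 0 ≤ b) (h : CuntzLE a b) {ε : ℝ}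
    (hε : 0 < ε) : ∃ δ > 0, CuntzLE (cut a ε) (cut b δ) := by
  rw [cuntzLE_iff_mem_closure, Metric.mem_closure_iff] at h
  obtain ⟨_, ⟨d, rfl⟩, hd⟩ := h (ε / 2) (half_pos hε)
  -- Replacing b by (b - δ)_+ moves d^* b d by at most δ‖d‖² ≤ ε/2, the other half of ε being spent
  -- on approximating a.
  set δ := ε / 2 / (‖d‖ * ‖d‖ + 1) with hδ
  have hδ0 : 0 < δ := by positivity
  refine ⟨δ, hδ0, (CuntzLE.cut_of_norm_le ha (star_left_conjugate_nonneg (cut_nonneg hb δ) d)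
    hε ?_).trans (.of_eq rfl)⟩
  have h1 : ‖star d * b * d - star d * cut b δ * d‖ ≤ ε / 2 := by
    rw [← sub_mul, ← mul_sub]
    calc ‖star d * (b - cut b δ) * d‖ ≤ ‖star d‖ * ‖b - cut b δ‖ * ‖d‖ := norm_mul₃_le
      _ ≤ ‖d‖ * δ * ‖d‖ := by
        rw [norm_star]; gcongr; exact norm_sub_cut_le hb hδ0.le
      _ = δ * (‖d‖ * ‖d‖) := by ring
      _ ≤ δ * (‖d‖ * ‖d‖ + 1) := by gcongr; linarith
      _ = ε / 2 := by rw [hδ]; field_simp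
  have h2 := norm_sub_le_norm_sub_add_norm_sub a (star d * b * d) (star d * cut b δ * d)
  rw [dist_eq_norm] at hd
  linarith

end Ordered

/-! ### Elementary tensors in A ⊗ K and the corner embedding -/

section StabStructure

theorem Corona.mk_eq_of_eventually {B : ℕ → Type*} [∀ n, NonUnitalCStarAlgebra (B n)]
    {x y : lp B ∞} (h : ∀ᶠ n in atTop, x n = y n) : Corona.mk x = Corona.mk y := by
  refine (Submodule.Quotient.eq _).2 (mem_nullSeq.2 (tendsto_const_nhds.congr' ?_))
  filter_upwards [h] with n hn
  have : (x - y) n = x n - y n := rfl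
  rw [this, hn, sub_self, norm_zero]

variable {A : Type*} [NonUnitalCStarAlgebra A] [PartialOrder A] [StarOrderedRing A]

theorem elemTensor_mul (i j l : ℕ) (a b : A) :
    elemTensor i j a * elemTensor j l b = elemTensor i l (a * b) := by
  refine Corona.mk_eq_of_eventually ?_
  filter_upwards [eventually_gt_atTop j] with n hn
  exact elemMat_mul i j a b n l hn

theorem elemMat_mul_of_ne {A : Type*} [NonUnitalCStarAlgebra A] {i j k l : ℕ} (h : j ≠ k)
    (a b : A) (n : ℕ) :
    elemMat i j a n * elemMat k l b n = 0 := by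
  ext r s
  rw [CStarMatrix.mul_apply]
  refine Finset.sum_eq_zero fun m _ => ?_
  rw [elemMat_apply, elemMat_apply]
  by_cases h1 : m.val = j
  · simp [h1, h]
  · simp [h1]

theorem elemTensor_mul_of_ne {i j k l : ℕ} (h : j ≠ k) (a b : A) :
    elemTensor i j a * elemTensor k l b = 0 :=
  Corona.mk_eq_of_eventually (y := 0) (.of_forall fun n => elemMat_mul_of_ne h a b n)

theorem star_elemTensor (i j : ℕ) (a : A) :
    star (elemTensor i j a) = elemTensor j i (star a) :=
  congrArg Corona.mk (Subtype.ext (funext fun n => elemMat_star i j a n))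

theorem smul_elemTensor (c : ℂ) (i j : ℕ) (a : A) :
    c • elemTensor i j a = elemTensor i j (c • a) := by
  refine congrArg Corona.mk (Subtype.ext (funext fun n => ?_))
  change c • elemMat i j a n = elemMat i j (c • a) n
  ext r s
  rw [CStarMatrix.smul_apply, elemMat_apply, elemMat_apply]
  split_ifs <;> simp

/-- The elementary tensor `a ⊗ e_{ij}` as an element of `A ⊗ K`. -/
def stabElem (i j : ℕ) (a : A) : Stab A :=
  (⟨elemTensor i j a, elemTensor_mem i j a⟩ : stabSubalgebra A)

theorem corner_apply (a : A) : corner a = stabElem 0 0 a := rfl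

theorem stabElem_mul (i j l : ℕ) (a b : A) :
    stabElem i j a * stabElem j l b = stabElem i l (a * b) :=
  Subtype.ext (elemTensor_mul i j l a b)

theorem stabElem_mul_of_ne {i j k l : ℕ} (h : j ≠ k) (a b : A) :
    stabElem i j a * stabElem k l b = 0 :=
  Subtype.ext (elemTensor_mul_of_ne h a b)

theorem star_stabElem (i j : ℕ) (a : A) : star (stabElem i j a) = stabElem j i (star a) :=
  Subtype.ext (star_elemTensor i j a)

theorem Stab.map_stabElem {B : Type*} [NonUnitalCStarAlgebra B] [PartialOrder B]
    [StarOrderedRing B] (φ : A →⋆ₙₐ[ℂ] B) (i j : ℕ) (a : A) :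
    Stab.map φ (stabElem i j a) = stabElem i j (φ a) :=
  Subtype.ext (coronaMap_elemTensor φ i j a)

theorem Stab.map_corner {B : Type*} [NonUnitalCStarAlgebra B] [PartialOrder B]
    [StarOrderedRing B] (φ : A →⋆ₙₐ[ℂ] B) (a : A) :
    Stab.map φ (corner a) = corner (φ a) :=
  Stab.map_stabElem φ 0 0 a

variable (A) in
/-- The sums of elementary tensors form a *-subalgebra. -/
def elemSubalgebra : NonUnitalStarSubalgebra ℂ (Corona (Mat A)) where
  __ := AddSubmonoid.closure {x | ∃ (i j : ℕ) (a : A), x = elemTensor i j a}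
  mul_mem' {x y} hx hy := by
    change _ ∈ AddSubmonoid.closure _
    change x ∈ AddSubmonoid.closure _ at hx
    change y ∈ AddSubmonoid.closure _ at hy
    induction hx using AddSubmonoid.closure_induction with
    | zero => rw [zero_mul]; exact zero_mem _
    | add a b _ _ ha hb => rw [add_mul]; exact add_mem ha hb
    | mem a ha =>
      obtain ⟨i, j, a, rfl⟩ := ha
      induction hy using AddSubmonoid.closure_induction with
      | zero => rw [mul_zero]; exact zero_mem _
      | add a b _ _ ha hb => rw [mul_add]; exact add_mem ha hb
      | mem b hb =>
        obtain ⟨k, l, b, rfl⟩ := hb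
        by_cases h : j = k
        · subst h
          rw [elemTensor_mul]
          exact AddSubmonoid.subset_closure ⟨_, _, _, rfl⟩
        · rw [elemTensor_mul_of_ne h]
          exact zero_mem _
  smul_mem' c x hx := by
    change _ ∈ AddSubmonoid.closure _
    change x ∈ AddSubmonoid.closure _ at hx
    induction hx using AddSubmonoid.closure_induction with
    | zero => rw [smul_zero]; exact zero_mem _
    | add a b _ _ ha hb => rw [smul_add]; exact add_mem ha hb
    | mem a ha =>
      obtain ⟨i, j, a, rfl⟩ := ha
      rw [smul_elemTensor]
      exact AddSubmonoid.subset_closure ⟨_, _, _, rfl⟩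
  star_mem' {x} hx := by
    change _ ∈ AddSubmonoid.closure _
    change x ∈ AddSubmonoid.closure _ at hx
    induction hx using AddSubmonoid.closure_induction with
    | zero => rw [star_zero]; exact zero_mem _
    | add a b _ _ ha hb => rw [star_add]; exact add_mem ha hb
    | mem a ha =>
      obtain ⟨i, j, a, rfl⟩ := ha
      rw [star_elemTensor]
      exact AddSubmonoid.subset_closure ⟨_, _, _, rfl⟩

/-- A closed additive property of elements of `A ⊗ K` need only be checked on elementary
tensors. -/
theorem Stab.induction {p : Stab A → Prop} (hp : IsClosed {s | p s}) (h0 : p 0)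
    (hadd : ∀ x y, p x → p y → p (x + y)) (helem : ∀ i j a, p (stabElem i j a)) (s : Stab A) :
    p s := by
  have hmem : ∀ x (hx : x ∈ AddSubmonoid.closure
      {x : Corona (Mat A) | ∃ (i j : ℕ) (a : A), x = elemTensor i j a}),
      ∃ h : x ∈ stabSubalgebra A, p (⟨x, h⟩ : stabSubalgebra A) := by
    intro x hx
    induction hx using AddSubmonoid.closure_induction with
    | zero => exact ⟨zero_mem _, h0⟩
    | add a b _ _ ha hb =>
      obtain ⟨ha, ha'⟩ := ha
      obtain ⟨hb, hb'⟩ := hb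
      exact ⟨add_mem ha hb, hadd _ _ ha' hb'⟩
    | mem a ha =>
      obtain ⟨i, j, a, rfl⟩ := ha
      exact ⟨elemTensor_mem i j a, helem i j a⟩
  -- Sums of elementary tensors are already closed under products, scalars and adjoints, so the
  -- generated *-subalgebra contains nothing else.
  have hle : NonUnitalStarAlgebra.adjoin ℂ {x | ∃ (i j : ℕ) (a : A), x = elemTensor i j a} ≤
      elemSubalgebra A :=
    NonUnitalStarAlgebra.adjoin_le fun x hx => AddSubmonoid.subset_closure hx
  have hemb : IsClosedEmbedding (Subtype.val : stabSubalgebra A → Corona (Mat A)) :=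
    (isClosed_stabSubalgebra A).isClosedEmbedding_subtypeVal
  have hcl : IsClosed (Subtype.val '' {s : stabSubalgebra A | p s}) :=
    hemb.isClosedMap _ hp
  have hs : s.1 ∈ closure (NonUnitalStarAlgebra.adjoin ℂ
      {x | ∃ (i j : ℕ) (a : A), x = elemTensor i j a} : Set (Corona (Mat A))) := s.2
  have h1 : s.1 ∈ Subtype.val '' {s : stabSubalgebra A | p s} := by
    refine closure_minimal (fun x hx => ?_) hcl hs
    obtain ⟨h, hx'⟩ := hmem x (hle hx)
    exact ⟨_, hx', rfl⟩
  obtain ⟨s', hs', he⟩ := h1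
  rwa [Subtype.ext he] at hs'

/-- The (0,0) entry of the representing sequence is constantly a from n = 1 on, so the sequence can
be null only if a = 0. -/
theorem corner_injective : Function.Injective (corner : A → Stab A) := by
  refine (injective_iff_map_eq_zero _).2 fun a ha => ?_
  have h1 : elemTensor 0 0 a = 0 := congrArg Subtype.val ha
  have h2 : elemSeq 0 0 a ∈ nullSeq (Mat A) := (Submodule.Quotient.mk_eq_zero _).1 h1
  have h3 : ‖a‖ ≤ 0 := by
    refine ge_of_tendsto (mem_nullSeq.1 h2) ?_
    filter_upwards [eventually_gt_atTop 0] with n hn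
    have h4 : elemMat 0 0 a n ⟨0, hn⟩ ⟨0, hn⟩ = a := by simp [elemMat_apply]
    conv_lhs => rw [← h4]
    exact CStarMatrix.norm_entry_le_norm
  exact norm_le_zero_iff.1 h3

theorem continuous_starHom {E F : Type*} [NonUnitalCStarAlgebra E] [NonUnitalCStarAlgebra F]
    (ψ : E →⋆ₙₐ[ℂ] F) : Continuous ψ :=
  AddMonoidHomClass.continuous_of_bound ψ 1 fun x => by
    simpa using NonUnitalStarAlgHom.norm_apply_le ψ x

theorem isometry_corner : Isometry (corner : A → Stab A) :=
  NonUnitalStarAlgHom.isometry corner corner_injective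

theorem isClosed_range_corner : IsClosed (Set.range (corner : A → Stab A)) :=
  isometry_corner.isClosedEmbedding.isClosed_range

theorem map_fc {E F : Type*} [NonUnitalCStarAlgebra E] [NonUnitalCStarAlgebra F]
    (ψ : E →⋆ₙₐ[ℂ] F) {f : ℝ → ℝ} (hf : Continuous f) (hf0 : f 0 = 0) {a : E}
    (ha : IsSelfAdjoint a) : ψ (cfcₙ f a) = cfcₙ f (ψ a) :=
  ψ.map_cfcₙ f a hf.continuousOn hf0 (continuous_starHom ψ) ha (ha.map ψ)

theorem corner_cut {a : A} (ha : 0 ≤ a) {t : ℝ} (ht : 0 ≤ t) :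
    corner (cut a t) = cut (corner a) t :=
  map_fc corner (by fun_prop) (by simp [ht]) ha.isSelfAdjoint

/-- The corner embedding reflects positivity. -/
theorem nonneg_of_corner_nonneg {a : A} (h : 0 ≤ corner a) : 0 ≤ a := by
  have hsa : IsSelfAdjoint a := corner_injective (by
    rw [map_star]; exact h.isSelfAdjoint.star_eq)
  -- The image of a equals its own positive part; by injectivity so does a.
  have h1 : corner (cfcₙ (fun t : ℝ => max t 0) a) = corner a := by
    rw [map_fc corner (by fun_prop) (by simp) hsa]
    conv_rhs => rw [← fc_id h]
    exact fc_congr h fun t ht => max_eq_left ht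
  rw [← corner_injective h1]
  exact cfcₙ_nonneg fun t _ => le_max_right _ _

/-- Compressing an element of `A ⊗ K` by elements of the corner gives an element of the
corner. -/
theorem exists_corner_eq_compress (q r : A) (s : Stab A) :
    ∃ c, corner c = corner q * s * corner r := by
  refine Stab.induction (p := fun s => ∃ c, corner c = corner q * s * corner r) ?_ ?_ ?_ ?_ s
  · exact isClosed_range_corner.preimage
      (by fun_prop : Continuous fun s : Stab A => corner q * s * corner r)
  · exact ⟨0, by simp⟩
  · rintro x y ⟨c, hc⟩ ⟨d, hd⟩
    exact ⟨c + d, by rw [map_add, hc, hd, mul_add, add_mul]⟩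
  · intro i j a
    by_cases hi : 0 = i
    · subst hi
      by_cases hj : j = 0
      · subst hj
        exact ⟨q * a * r, by simp [corner_apply, stabElem_mul]⟩
      · refine ⟨0, ?_⟩
        rw [mul_assoc, corner_apply r, stabElem_mul_of_ne hj, mul_zero, map_zero]
    · exact ⟨0, by rw [corner_apply q, stabElem_mul_of_ne hi, zero_mul, map_zero]⟩

theorem Cu.ofElem_le_ofElem {a b : A} (ha : 0 ≤ a) (hb : 0 ≤ b) (h : CuntzLE a b) :
    Cu.ofElem a ha ≤ Cu.ofElem b hb := CuntzLE.map corner h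

end StabStructure

/-! ### Compression of A ⊗ K to the corner -/

section Compression

variable {A : Type*} [NonUnitalCStarAlgebra A] [PartialOrder A] [StarOrderedRing A]

/-- The element `c` of `A` with `c ⊗ e₀₀ = (q ⊗ e₀₀) s (q ⊗ e₀₀)`. -/
def compress (q : A) (s : Stab A) : A := (exists_corner_eq_compress q q s).choose

theorem corner_compress (q : A) (s : Stab A) :
    corner (compress q s) = corner q * s * corner q :=
  (exists_corner_eq_compress q q s).choose_spec

theorem compress_add (q : A) (s s' : Stab A) :
    compress q (s + s') = compress q s + compress q s' :=
  corner_injective (by simp only [corner_compress, map_add, mul_add, add_mul])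

theorem compress_neg (q : A) (s : Stab A) : compress q (-s) = -compress q s :=
  corner_injective (by simp only [corner_compress, map_neg, mul_neg, neg_mul])

/-- Commuting q past u and v makes compression a bimodule map. Over the commutative cone this always
applies, and scalar cut-offs can be pulled out of a compression. -/
theorem compress_corner_mul {q u v : A} (hu : Commute q u) (hv : Commute q v) (s : Stab A) :
    compress q (corner u * s * corner v) = u * compress q s * v := by
  refine corner_injective ?_
  simp only [corner_compress, map_mul]
  have h1 : corner q * corner u = corner u * corner q := by
    rw [← map_mul, hu.eq, map_mul]
  have h2 : corner v * corner q = corner q * corner v := by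
    rw [← map_mul, ← hv.eq, map_mul]
  calc corner q * (corner u * s * corner v) * corner q
      = (corner q * corner u) * s * (corner v * corner q) := by noncomm_ring
    _ = _ := by rw [h1, h2]; noncomm_ring

end Compression

/-! ### Pointwise analysis over the cone, and [e_t] ≪ [e_s] for s < t -/

section ConeCompact

/-- Evaluation at a point of `(0,1]`. -/
def evalHom (x : Set.Ioc (0 : ℝ) 1) : Cone →⋆ₙₐ[ℂ] ℂ where
  toFun f := f x
  map_smul' _ _ := rfl
  map_zero' := rfl
  map_add' _ _ := rfl
  map_mul' _ _ := rfl
  map_star' _ := rfl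

theorem evalHom_apply (x : Set.Ioc (0 : ℝ) 1) (f : Cone) : evalHom x f = f x := rfl

theorem Cone.nonneg_of_forall {f : Cone} (h : ∀ x, 0 ≤ f x) : 0 ≤ f := by
  let s : Cone :=
    { toFun := fun x => ((√(f x).re : ℝ) : ℂ)
      continuous_toFun := by
        have := f.continuous
        fun_prop
      zero_at_infty' := by
        have h1 : Continuous fun z : ℂ => ((√z.re : ℝ) : ℂ) := by fun_prop
        have h2 := (h1.tendsto 0).comp f.zero_at_infty'
        rw [Complex.zero_re, Real.sqrt_zero, Complex.ofReal_zero] at h2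
        exact h2 }
  have hs : f = star s * s := by
    ext x
    change f x = star ((√(f x).re : ℝ) : ℂ) * ((√(f x).re : ℝ) : ℂ)
    obtain ⟨h1, h2⟩ := Complex.nonneg_iff.1 (h x)
    rw [Complex.star_def, Complex.conj_ofReal, ← Complex.ofReal_mul, Real.mul_self_sqrt h1]
    exact Complex.ext (by simp) (by simp [← h2])
  rw [hs]
  exact star_mul_self_nonneg _

theorem Cone.apply_nonneg {f : Cone} (h : 0 ≤ f) (x : Set.Ioc (0 : ℝ) 1) : 0 ≤ f x :=
  map_pos_elem (evalHom x) h

theorem Cone.commute (f g : Cone) : Commute f g :=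
  ZeroAtInftyContinuousMap.ext fun _ => mul_comm _ _

/-- A positive element of the stabilized cone vanishes at `x` if all its diagonal entries do. -/
theorem Stab.map_evalHom_eq_zero {a : Stab Cone} (ha : 0 ≤ a) {x : Set.Ioc (0 : ℝ) 1} {q : Cone}
    (hq : q x = 1)
    (h : ∀ i, compress q (star (stabElem i 0 q) * a * stabElem i 0 q) x = 0) :
    Stab.map (evalHom x) a = 0 := by
  have hA : 0 ≤ Stab.map (evalHom x) a := map_pos_elem _ ha
  obtain ⟨B, hB⟩ := CStarAlgebra.nonneg_iff_eq_star_mul_self.1 hA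
  -- The i-th diagonal entry of B^* B is the square of the i-th column of B, so that column is zero.
  -- Here q stands in for a unit of the cone at x.
  have h1 : ∀ i, B * stabElem i 0 1 = 0 := by
    intro i
    have h2 := congrArg (Stab.map (evalHom x)) (corner_compress q
      (star (stabElem i 0 q) * a * stabElem i 0 q))
    rw [Stab.map_corner, evalHom_apply, h i, map_zero] at h2
    simp only [map_mul, map_star, Stab.map_stabElem, corner_apply, evalHom_apply, hq, hB] at h2
    rw [← CStarRing.star_mul_self_eq_zero_iff]
    have h3 : stabElem i 0 (1 : ℂ) * stabElem 0 0 1 = stabElem i 0 1 := by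
      rw [stabElem_mul, mul_one]
    have h4 : star (stabElem i 0 (1 : ℂ)) = stabElem 0 0 1 * star (stabElem i 0 1) := by
      rw [star_stabElem, stabElem_mul, star_one, mul_one]
    rw [star_mul, h4]
    nth_rw 2 [← h3]
    rw [h2]
    noncomm_ring
  have h2 : ∀ s, B * s = 0 := by
    refine Stab.induction ?_ (mul_zero _) (fun x y hx hy => by rw [mul_add, hx, hy, add_zero]) ?_
    · exact isClosed_eq (by fun_prop) continuous_const
    · intro i j z
      have : stabElem i j z = stabElem i 0 1 * stabElem 0 j z := by rw [stabElem_mul, one_mul]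
      rw [this, ← mul_assoc, h1, zero_mul]
  have h3 : B = 0 := (CStarRing.mul_star_self_eq_zero_iff B).1 (h2 _)
  rw [hB, h3, mul_zero]

/-- The function `min (x / t) 1`. -/
def plateau (t : ℝ) : Cone := coneFun (fun x => min (x / t) 1) (by fun_prop) (by simp)

theorem plateau_apply {t : ℝ} (ht : 0 < t) {x : Set.Ioc (0 : ℝ) 1} (hx : t ≤ x) :
    plateau t x = 1 := by
  change ((min ((x : ℝ) / t) 1 : ℝ) : ℂ) = 1
  rw [min_eq_right ((one_le_div ht).2 hx), Complex.ofReal_one]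

/-- The two-dimensional interpolation step. -/
theorem exists_patch_step {t : ℝ} (ht : 0 < t) (a : Stab Cone) (q : Cone) {y z : Set.Ioc (0 : ℝ) 1}
    (hty : t ≤ y) (hyz : y ≤ z) {e e' : Stab Cone}
    (he : ∀ x : Set.Ioc (0 : ℝ) 1, t ≤ x → x ≤ y → 0 < (compress q (star e * a * e) x).re)
    (he' : ∀ x, y ≤ x → x ≤ z → 0 < (compress q (star e' * a * e') x).re) :
    ∃ e'' : Stab Cone, ∀ x : Set.Ioc (0 : ℝ) 1, t ≤ x → x ≤ z →
      0 < (compress q (star e'' * a * e'') x).re := by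
  -- Replacing e' by -e' changes only the sign of the cross term, so it may be taken nonnegative at
  -- y.
  wlog hG : 0 ≤ (compress q (star e * a * e') y + compress q (star e' * a * e) y).re
    generalizing e'
  · refine this (e' := -e') ?_ ?_
    · simpa using he'
    · push Not at hG
      simp only [mul_neg, star_neg, neg_mul, compress_neg, ZeroAtInftyContinuousMap.neg_apply,
        Complex.add_re, Complex.neg_re] at hG ⊢
      linarith
  set F := compress q (star e * a * e) with hF
  set F' := compress q (star e' * a * e') with hF'
  set G := compress q (star e * a * e') with hGd
  set G' := compress q (star e' * a * e) with hGd'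
  have hFy : 0 < (F y).re := he y hty le_rfl
  have hFy' : 0 < (F' y).re := he' y le_rfl hyz
  obtain ⟨m, hm, hmF, hmF'⟩ : ∃ m > 0, m < (F y).re ∧ m < (F' y).re :=
    ⟨min (F y).re (F' y).re / 2, by positivity,
      by linarith [min_le_left (F y).re (F' y).re, lt_min hFy hFy'],
      by linarith [min_le_right (F y).re (F' y).re, lt_min hFy hFy']⟩
  have hev : ∀ᶠ x in 𝓝 y, m < (F x).re ∧ m < (F' x).re ∧ -m < (G x + G' x).re := by
    have c1 : Continuous fun x => (F x).re := by have := F.continuous; fun_prop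
    have c2 : Continuous fun x => (F' x).re := by have := F'.continuous; fun_prop
    have c3 : Continuous fun x => (G x + G' x).re := by
      have := G.continuous; have := G'.continuous; fun_prop
    exact (c1.continuousAt.eventually (lt_mem_nhds hmF)).and
      ((c2.continuousAt.eventually (lt_mem_nhds hmF')).and
        (c3.continuousAt.eventually (lt_mem_nhds (by linarith))))
  obtain ⟨η, hη, hball⟩ := Metric.eventually_nhds_iff.1 hev
  -- On [t,1], u is 1 up to y and falls to 0 at y + η, while v rises from 0 at y - η to 1 at y and
  -- stays there. The factor min (x / t) 1 only makes them vanish at 0.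
  let u : Cone := coneFun (fun x => min (x / t) 1 * max 0 (min 1 (1 - (x - y) / η)))
    (by fun_prop) (by simp)
  let v : Cone := coneFun (fun x => min (x / t) 1 * max 0 (min 1 (1 + (x - y) / η)))
    (by fun_prop) (by simp)
  have hsu : star u = u := by
    ext x; exact Complex.conj_ofReal _
  have hsv : star v = v := by
    ext x; exact Complex.conj_ofReal _
  have hu : ∀ x : Set.Ioc (0 : ℝ) 1, t ≤ x →
      u x = ((max 0 (min 1 (1 - ((x : ℝ) - y) / η)) : ℝ) : ℂ) := fun x hx => by
    change ((min ((x : ℝ) / t) 1 * _ : ℝ) : ℂ) = _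
    rw [min_eq_right ((one_le_div ht).2 hx), one_mul]
  have hv : ∀ x : Set.Ioc (0 : ℝ) 1, t ≤ x →
      v x = ((max 0 (min 1 (1 + ((x : ℝ) - y) / η)) : ℝ) : ℂ) := fun x hx => by
    change ((min ((x : ℝ) / t) 1 * _ : ℝ) : ℂ) = _
    rw [min_eq_right ((one_le_div ht).2 hx), one_mul]
  have hcomp : compress q (star (e * corner u + e' * corner v) * a * (e * corner u + e' * corner v))
      = u * F * u + u * G * v + (v * G' * u + v * F' * v) := by
    have hexp : star (e * corner u + e' * corner v) * a * (e * corner u + e' * corner v) =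
        corner u * (star e * a * e) * corner u + corner u * (star e * a * e') * corner v +
        (corner v * (star e' * a * e) * corner u + corner v * (star e' * a * e') * corner v) := by
      rw [star_add, star_mul, star_mul, ← map_star, ← map_star, hsu, hsv]
      noncomm_ring
    rw [hexp, compress_add, compress_add, compress_add]
    simp only [compress_corner_mul (Cone.commute _ _) (Cone.commute _ _)]
    rfl
  refine ⟨e * corner u + e' * corner v, fun x htx hxz => ?_⟩
  have hval : (compress q (star (e * corner u + e' * corner v) * a *
      (e * corner u + e' * corner v)) x).re =
      (max 0 (min 1 (1 - ((x : ℝ) - y) / η))) ^ 2 * (F x).re +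
      (max 0 (min 1 (1 - ((x : ℝ) - y) / η))) * (max 0 (min 1 (1 + ((x : ℝ) - y) / η))) *
        (G x + G' x).re +
      (max 0 (min 1 (1 + ((x : ℝ) - y) / η))) ^ 2 * (F' x).re := by
    rw [hcomp]
    simp only [ZeroAtInftyContinuousMap.add_apply, ZeroAtInftyContinuousMap.mul_apply, hu x htx,
      hv x htx, Complex.add_re, Complex.mul_re, Complex.mul_im, Complex.ofReal_re,
      Complex.ofReal_im]
    ring
  rw [hval]
  have hyx : ∀ {r : ℝ}, (x : ℝ) - y ≤ r → ((x : ℝ) - y) / η ≤ r / η := fun h => by gcongr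
  have hxy : ∀ {r : ℝ}, r ≤ (x : ℝ) - y → r / η ≤ ((x : ℝ) - y) / η := fun h => by gcongr
  -- Near y one of u, v equals 1 and the other is some β in [0,1], so the value exceeds m - β m + β²
  -- m ≥ 0. Away from y one of them is 0 and the other 1, and only F or F' survives.
  by_cases hnear : dist x y < η
  · obtain ⟨h1, h2, h3⟩ := hball hnear
    rcases le_total (x : ℝ) y with hle | hle
    · have h4 := hyx (r := 0) (by linarith)
      rw [zero_div] at h4
      rw [min_eq_left (a := (1 : ℝ)) (b := 1 - _) (by linarith), max_eq_right zero_le_one]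
      set β := max 0 (min 1 (1 + ((x : ℝ) - y) / η))
      have hβ0 : 0 ≤ β := le_max_left _ _
      have hβ1 : β ≤ 1 := max_le zero_le_one (min_le_left _ _)
      nlinarith [mul_nonneg hβ0 hβ0, mul_le_mul_of_nonneg_left h3.le hβ0,
        mul_le_mul_of_nonneg_left h2.le (mul_nonneg hβ0 hβ0)]
    · have h4 := hxy (r := 0) (by linarith)
      rw [zero_div] at h4
      rw [min_eq_left (a := (1 : ℝ)) (b := 1 + _) (by linarith), max_eq_right zero_le_one]
      set β := max 0 (min 1 (1 - ((x : ℝ) - y) / η))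
      have hβ0 : 0 ≤ β := le_max_left _ _
      have hβ1 : β ≤ 1 := max_le zero_le_one (min_le_left _ _)
      nlinarith [mul_nonneg hβ0 hβ0, mul_le_mul_of_nonneg_left h3.le hβ0,
        mul_le_mul_of_nonneg_left h1.le (mul_nonneg hβ0 hβ0)]
  · rw [Subtype.dist_eq, Real.dist_eq, not_lt, le_abs] at hnear
    rcases hnear with hnear | hnear
    · have h4 := hxy hnear
      rw [div_self hη.ne'] at h4
      have h5 : max 0 (min 1 (1 - ((x : ℝ) - y) / η)) = 0 :=
        max_eq_left ((min_le_right _ _).trans (by linarith))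
      have h6 : max 0 (min 1 (1 + ((x : ℝ) - y) / η)) = 1 := by
        rw [min_eq_left (by linarith), max_eq_right zero_le_one]
      rw [h5, h6]
      have := he' x (Subtype.coe_le_coe.1 (by linarith)) hxz
      linarith
    · have h4 := hyx (r := -η) (by linarith)
      rw [neg_div, div_self hη.ne'] at h4
      have h5 : max 0 (min 1 (1 + ((x : ℝ) - y) / η)) = 0 :=
        max_eq_left ((min_le_right _ _).trans (by linarith))
      have h6 : max 0 (min 1 (1 - ((x : ℝ) - y) / η)) = 1 := by
        rw [min_eq_left (by linarith), max_eq_right zero_le_one]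
      rw [h5, h6]
      have := he x htx (Subtype.coe_le_coe.1 (by linarith))
      linarith

/-- Local positivity becomes global by subdividing [t,1] so finely that one e_i serves each piece,
then gluing the pieces from left to right. That the base is one-dimensional is essential:
consecutive pieces meet in a single point, where one choice of sign controls the cross term. -/
theorem exists_patch {t : ℝ} (ht : 0 < t) (ht1 : t ≤ 1) (a : Stab Cone) (q : Cone)
    (e : ℕ → Stab Cone)
    (he : ∀ x : Set.Ioc (0 : ℝ) 1, t ≤ x → ∃ i, 0 < (compress q (star (e i) * a * e i) x).re) :
    ∃ e' : Stab Cone, ∀ x : Set.Ioc (0 : ℝ) 1, t ≤ x →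
      0 < (compress q (star e' * a * e') x).re := by
  let ι : Set.Icc t 1 → Set.Ioc (0 : ℝ) 1 := fun x => ⟨x, ht.trans_le x.2.1, x.2.2⟩
  have hι : Continuous ι := by fun_prop
  obtain ⟨p, hp0, hpm, ⟨N, hN⟩, hpc⟩ := exists_monotone_Icc_subset_open_cover_Icc ht1
    (c := fun i => {x : Set.Icc t 1 | 0 < (compress q (star (e i) * a * e i) (ι x)).re})
    (fun i => by
      refine isOpen_lt continuous_const ?_
      have := (compress q (star (e i) * a * e i)).continuous
      fun_prop)
    (fun x _ => by
      obtain ⟨i, hi⟩ := he (ι x) x.2.1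
      exact Set.mem_iUnion.2 ⟨i, hi⟩)
  have key : ∀ n, ∃ e' : Stab Cone, ∀ x : Set.Ioc (0 : ℝ) 1, t ≤ x → x ≤ ι (p n) →
      0 < (compress q (star e' * a * e') x).re := by
    intro n
    induction n with
    | zero =>
      obtain ⟨i, hi⟩ := he ⟨t, ht, ht1⟩ le_rfl
      refine ⟨e i, fun x hx hx' => ?_⟩
      have hxt : x = ⟨t, ht, ht1⟩ := by
        refine Subtype.ext (le_antisymm ?_ hx)
        have h1 : (x : ℝ) ≤ p 0 := hx'
        rwa [hp0] at h1
      rwa [hxt]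
    | succ n ih =>
      obtain ⟨e', he'⟩ := ih
      obtain ⟨i, hi⟩ := hpc n
      refine exists_patch_step ht a q (y := ι (p n)) (z := ι (p (n + 1))) (p n).2.1
        (hpm n.le_succ) he' (e' := e i) fun x hx hx' => ?_
      have h1 : (⟨x, (p n).2.1.trans hx, x.2.2⟩ : Set.Icc t 1) ∈
          Set.Icc (p n) (p (n + 1)) := ⟨hx, hx'⟩
      exact hi h1
  obtain ⟨e', he'⟩ := key N
  refine ⟨e', fun x hx => he' x hx ?_⟩
  have h1 : ((p N : Set.Icc t 1) : ℝ) = 1 := by rw [hN N le_rfl]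
  change (x : ℝ) ≤ p N
  rw [h1]
  exact x.2.2

theorem isCompact_coe_ge {t : ℝ} (ht : 0 < t) :
    IsCompact {x : Set.Ioc (0 : ℝ) 1 | t ≤ x} := by
  refine Subtype.isCompact_iff.2 ?_
  have : Subtype.val '' {x : Set.Ioc (0 : ℝ) 1 | t ≤ x} = Set.Icc t 1 := by
    ext r
    constructor
    · rintro ⟨x, hx, rfl⟩; exact ⟨hx, x.2.2⟩
    · intro hr; exact ⟨⟨r, ht.trans_le hr.1, hr.2⟩, hr.1, rfl⟩
  rw [this]
  exact isCompact_Icc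

/-- If a positive element of the stabilized cone vanishes nowhere on `[t,1]`, then it Cuntz
dominates `e_t`. -/
theorem cuntzLE_corner_cutFun {t : NNReal} (ht : 0 < t) (ht1 : t ≤ 1) {a : Stab Cone} (ha : 0 ≤ a)
    (h : ∀ x : Set.Ioc (0 : ℝ) 1, (t : ℝ) ≤ x → Stab.map (evalHom x) a ≠ 0) :
    CuntzLE (corner (cutFun t)) a := by
  have ht' : (0 : ℝ) < t := ht
  set q := plateau t with hq
  have hpos : ∀ e : Stab Cone, 0 ≤ compress q (star e * a * e) := fun e => by
    refine nonneg_of_corner_nonneg ?_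
    have hqs : star (corner q) = corner q := by
      rw [← map_star]; congr 1; ext x; exact Complex.conj_ofReal _
    rw [corner_compress]
    nth_rw 1 [← hqs]
    exact star_left_conjugate_nonneg (star_left_conjugate_nonneg ha e) _
  obtain ⟨e, he⟩ := exists_patch ht' (by exact_mod_cast ht1) a q (fun i => stabElem i 0 q)
    fun x hx => by
      by_contra! hcon
      refine h x hx (Stab.map_evalHom_eq_zero ha (plateau_apply ht' hx) fun i => ?_)
      have h1 := Cone.apply_nonneg (hpos (stabElem i 0 q)) x
      obtain ⟨h2, h3⟩ := Complex.nonneg_iff.1 h1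
      exact Complex.ext (le_antisymm (hcon i) h2) h3.symm
  set F := compress q (star e * a * e) with hF
  have hFc : Continuous fun x => (F x).re := by have := F.continuous; fun_prop
  obtain ⟨x₀, hx₀, hmin⟩ := (isCompact_coe_ge ht').exists_isMinOn
    ⟨⟨1, one_pos, le_rfl⟩, by exact_mod_cast ht1⟩ hFc.continuousOn
  set m := (F x₀).re with hm
  have hm0 : 0 < m := he x₀ hx₀
  -- On [t,1] the right side is at least 1 ≥ e_t; elsewhere e_t is zero and F is nonnegative.
  have hle : cutFun t ≤ m⁻¹ • F := by
    rw [← sub_nonneg]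
    refine Cone.nonneg_of_forall fun x => ?_
    obtain ⟨h2, h3⟩ := Complex.nonneg_iff.1 (Cone.apply_nonneg (hpos e) x)
    replace h3 : (F x).im = 0 := h3.symm
    replace h2 : 0 ≤ (F x).re := h2
    change 0 ≤ ((m⁻¹ : ℝ) • F x : ℂ) - ((max ((x : ℝ) - t) 0 : ℝ) : ℂ)
    rw [Complex.nonneg_iff]
    simp only [Complex.sub_re, Complex.smul_re, Complex.ofReal_re, Complex.sub_im, Complex.smul_im,
      Complex.ofReal_im, smul_eq_mul, h3, mul_zero, sub_zero, and_true]
    rw [sub_nonneg]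
    rcases le_total (t : ℝ) x with hx | hx
    · have h4 : m ≤ (F x).re := hmin hx
      have h5 : 1 ≤ m⁻¹ * (F x).re := by
        rw [inv_mul_eq_div, one_le_div hm0]; exact h4
      refine (max_le ?_ zero_le_one).trans h5
      linarith [x.2.2]
    · rw [max_eq_right (by linarith)]
      positivity
  have h1 : CuntzLE (corner (cutFun t)) (corner F) :=
    (CuntzLE.of_le_smul (cutFun_nonneg t) (inv_nonneg.2 hm0.le) hle).map corner
  refine h1.trans (.of_eq (d := e * corner q) ?_)
  have hqs : star (corner q) = corner q := by
    rw [← map_star]; congr 1; ext x; exact Complex.conj_ofReal _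
  rw [corner_compress, star_mul, hqs]
  noncomm_ring

theorem compress_apply_eq_zero {a : Stab Cone} {x : Set.Ioc (0 : ℝ) 1}
    (h : Stab.map (evalHom x) a = 0) (q : Cone) (e : Stab Cone) :
    compress q (star e * a * e) x = 0 := by
  have h2 := congrArg (Stab.map (evalHom x)) (corner_compress q (star e * a * e))
  simp only [map_mul, h, mul_zero, zero_mul, Stab.map_corner] at h2
  exact corner_injective (h2.trans (map_zero corner).symm)

theorem cutClass_antitone {s t : NNReal} (h : s ≤ t) : cutClass t ≤ cutClass s := by
  refine Cu.ofElem_le_ofElem _ _ (.of_le (cutFun_nonneg t) ?_)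
  rw [← sub_nonneg]
  refine Cone.nonneg_of_forall fun x => ?_
  change 0 ≤ ((max ((x : ℝ) - s) 0 : ℝ) : ℂ) - ((max ((x : ℝ) - t) 0 : ℝ) : ℂ)
  rw [← Complex.ofReal_sub, Complex.zero_le_real, sub_nonneg]
  have : (s : ℝ) ≤ t := h
  exact max_le_max (by linarith) le_rfl

/-- Countably many positive elements have a common Cuntz upper bound in every closed ideal
containing them. -/
theorem exists_cuntz_bound {D E : Type*} [NonUnitalCStarAlgebra D] [PartialOrder D]
    [StarOrderedRing D] [NonUnitalCStarAlgebra E] (ψ : D →⋆ₙₐ[ℂ] E) (a : ℕ → D)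
    (ha : ∀ k, 0 ≤ a k) (hψ : ∀ k, ψ (a k) = 0) :
    ∃ v, 0 ≤ v ∧ ψ v = 0 ∧ ∀ k, CuntzLE (a k) v := by
  -- The bound is the convergent sum Σ c_k a_k; each a_k is at most c_k⁻¹ times it.
  set c : ℕ → ℝ := fun k => (1 / 2) ^ k * (‖a k‖ + 1)⁻¹ with hc
  have hc0 : ∀ k, 0 < c k := fun k => by positivity
  have hs : Summable fun k => c k • a k := by
    refine Summable.of_norm_bounded (g := fun k => (1 / 2 : ℝ) ^ k)
      summable_geometric_two fun k => ?_
    rw [norm_smul, Real.norm_of_nonneg (hc0 k).le, hc]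
    have h1 : (‖a k‖ + 1)⁻¹ * ‖a k‖ ≤ 1 := by
      rw [inv_mul_eq_div]
      exact div_le_one_of_le₀ (by linarith) (by positivity)
    calc (1 / 2 : ℝ) ^ k * (‖a k‖ + 1)⁻¹ * ‖a k‖
        = (1 / 2 : ℝ) ^ k * ((‖a k‖ + 1)⁻¹ * ‖a k‖) := by ring
      _ ≤ (1 / 2 : ℝ) ^ k * 1 := by gcongr
      _ = _ := mul_one _
  have hn : ∀ k, 0 ≤ c k • a k := fun k => smul_nonneg (hc0 k).le (ha k)
  refine ⟨∑' k, c k • a k, tsum_nonneg hn, ?_, fun k => ?_⟩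
  · have h1 := hs.hasSum.map ψ (continuous_starHom ψ)
    refine h1.unique ?_
    have h2 : (ψ ∘ fun k => c k • a k) = fun _ => 0 := by
      funext k
      have : c k • a k = (c k : ℂ) • a k := (Complex.coe_smul _ _).symm
      simp only [Function.comp_apply, this, map_smul, hψ k, smul_zero]
    rw [h2]
    exact hasSum_zero
  · refine .of_le_smul (ha k) (inv_nonneg.2 (hc0 k).le) ?_
    have h1 : c k • a k ≤ ∑' k, c k • a k := hs.le_tsum k fun j _ => hn j
    calc a k = (c k)⁻¹ • (c k • a k) := by rw [smul_smul, inv_mul_cancel₀ (hc0 k).ne', one_smul]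
      _ ≤ _ := smul_le_smul_of_nonneg_left h1 (inv_nonneg.2 (hc0 k).le)

/-- In `Cu(C_0(0,1])` one has `[e_t] ≪ [e_s]` for `s < t`. -/
theorem cutClass_farBelow {s t : NNReal} (hst : s < t) : FarBelow (cutClass t) (cutClass s) := by
  intro u hu S hS hle
  by_cases ht1 : 1 ≤ t
  · rw [cutClass_eq_zero ht1]
    exact ⟨0, Cu.zero_le _⟩
  replace ht1 : t ≤ 1 := (not_le.1 ht1).le
  have ht : 0 < t := zero_le.trans_lt hst
  have ht' : (0 : ℝ) < t := ht
  by_contra! hno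
  choose a ha hua using fun k => Cu.exists_rep (u k)
  set q := plateau t
  -- The points of [t,1] at which a_k vanishes. Describing them by scalar functions makes closedness
  -- visible; `hK` returns to the evaluation of a_k.
  let K : ℕ → Set (Set.Ioc (0 : ℝ) 1) := fun k =>
    {x | (t : ℝ) ≤ x ∧ ∀ i, compress q (star (stabElem i 0 q) * a k * stabElem i 0 q) x = 0}
  have hK : ∀ k x, x ∈ K k ↔ (t : ℝ) ≤ x ∧ Stab.map (evalHom x) (a k) = 0 := fun k x =>
    and_congr_right fun hx => ⟨fun h => Stab.map_evalHom_eq_zero (ha k) (plateau_apply ht' hx) h,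
      fun h i => compress_apply_eq_zero h q _⟩
  have hne : ∀ k, (K k).Nonempty := by
    intro k
    by_contra hcon
    rw [Set.not_nonempty_iff_eq_empty, Set.eq_empty_iff_forall_notMem] at hcon
    refine hno k ?_
    rw [hua k]
    exact cuntzLE_corner_cutFun ht ht1 (ha k) fun x hx h0 => hcon x ((hK k x).2 ⟨hx, h0⟩)
  have hanti : ∀ k, K (k + 1) ⊆ K k := by
    intro k x hx
    rw [hK] at hx ⊢
    refine ⟨hx.1, ?_⟩
    have h1 : u k ≤ u (k + 1) := hu k.le_succ
    rw [hua k, hua (k + 1), Cu.mk_le_mk] at h1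
    have h2 := h1.map (Stab.map (evalHom x))
    rw [hx.2] at h2
    exact h2.eq_zero
  have hclosed : ∀ k, IsClosed (K k) := by
    intro k
    have h1 : K k = {x : Set.Ioc (0 : ℝ) 1 | (t : ℝ) ≤ x} ∩ ⋂ i, {x | compress q
        (star (stabElem i 0 q) * a k * stabElem i 0 q) x = 0} := by
      ext x; simp [K]
    rw [h1]
    refine (isClosed_le continuous_const continuous_subtype_val).inter
      (isClosed_iInter fun i => ?_)
    have := (compress q (star (stabElem i 0 q) * a k * stabElem i 0 q)).continuous
    exact isClosed_eq this continuous_const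
  have hcpt : IsCompact (K 0) :=
    (isCompact_coe_ge ht').of_isClosed_subset (hclosed 0) fun x hx => hx.1
  obtain ⟨x, hx⟩ := IsCompact.nonempty_iInter_of_sequence_nonempty_isCompact_isClosed K hanti hne
    hcpt hclosed
  rw [Set.mem_iInter] at hx
  -- Any least upper bound lies below [v], so it vanishes at x although e_s does not. No description
  -- of suprema in the Cuntz semigroup is needed.
  obtain ⟨v, hv, hv0, hav⟩ := exists_cuntz_bound (Stab.map (evalHom x)) a ha
    fun k => ((hK k x).1 (hx k)).2
  have hSv : S ≤ Cu.mk v hv := by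
    refine hS.2 ?_
    rintro _ ⟨k, rfl⟩
    rw [hua k]
    exact hav k
  have h1 : CuntzLE (corner (cutFun s)) v := hle.trans hSv
  have h2 := h1.map (Stab.map (evalHom x))
  rw [hv0, Stab.map_corner] at h2
  have h3 : evalHom x (cutFun s) = 0 := corner_injective (h2.eq_zero.trans (map_zero corner).symm)
  change ((max ((x : ℝ) - s) 0 : ℝ) : ℂ) = 0 at h3
  rw [Complex.ofReal_eq_zero] at h3
  have h4 : (t : ℝ) ≤ x := (hx 0).1
  have h5 : (s : ℝ) < t := hst
  have h6 := le_max_left ((x : ℝ) - s) 0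
  linarith

end ConeCompact

/-! ### Cut-downs as approximants of a class, and soft units -/

section Realization

theorem Cu.isLUB_cut {A : Type*} [NonUnitalCStarAlgebra A] [PartialOrder A] [StarOrderedRing A]
    {a : Stab A} (ha : 0 ≤ a) :
    IsLUB (Set.range fun n : ℕ => Cu.mk (cut a (1 / (n + 1))) (cut_nonneg ha _)) (Cu.mk a ha) := by
  constructor
  · rintro _ ⟨n, rfl⟩
    exact CuntzLE.cut_self ha (by positivity)
  · intro y hy
    obtain ⟨c, hc, rfl⟩ := y.exists_rep
    refine CuntzLE.of_cut ha fun ε hε => ?_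
    obtain ⟨n, hn⟩ := exists_nat_one_div_lt hε
    have h1 : CuntzLE (cut a (1 / ((n : ℝ) + 1))) c := hy ⟨n, rfl⟩
    exact (CuntzLE.cut_cut ha (by positivity) hn.le).trans h1

theorem FarBelow.exists_cut {A : Type*} [NonUnitalCStarAlgebra A] [PartialOrder A]
    [StarOrderedRing A] {x : Cu A} {a : Stab A} (ha : 0 ≤ a) (h : FarBelow x (Cu.mk a ha)) :
    ∃ ε > 0, x ≤ Cu.mk (cut a ε) (cut_nonneg ha ε) := by
  have hmono : Monotone fun n : ℕ => Cu.mk (cut a (1 / ((n : ℝ) + 1))) (cut_nonneg ha _) := by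
    intro m n hmn
    refine CuntzLE.cut_cut ha (by positivity) ?_
    gcongr
  obtain ⟨k, hk⟩ := h _ hmono _ (Cu.isLUB_cut ha) le_rfl
  exact ⟨_, by positivity, hk⟩

/-- The function `min (t / η) 1 ^ 2`, for `t ≥ 0`. -/
def softUnit (η t : ℝ) : ℝ := t / max η t * (t / max η t)

theorem continuous_softUnit {η : ℝ} (hη : 0 < η) : Continuous (softUnit η) :=
  (continuous_div_max hη continuous_id').mul (continuous_div_max hη continuous_id')

theorem softUnit_zero (η : ℝ) : softUnit η 0 = 0 := by simp [softUnit]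

theorem softUnit_nonneg (η t : ℝ) : 0 ≤ softUnit η t := mul_self_nonneg _

theorem softUnit_le_one {η t : ℝ} (ht : 0 ≤ t) : softUnit η t ≤ 1 := by
  have h1 : 0 ≤ t / max η t := div_nonneg ht (ht.trans (le_max_right _ _))
  have h2 : t / max η t ≤ 1 := div_le_one_of_le₀ (le_max_right _ _) (ht.trans (le_max_right _ _))
  exact mul_le_one₀ h2 h1 h2

theorem softUnit_of_le {η t : ℝ} (hη : 0 < η) (h : η ≤ t) : softUnit η t = 1 := by
  rw [softUnit, max_eq_right h, div_self (hη.trans_le h).ne', one_mul]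

theorem softUnit_of_ge {η t : ℝ} (h : t ≤ η) : softUnit η t = t / η * (t / η) := by
  rw [softUnit, max_eq_left h]

/-- `softUnit η b` acts as a unit on `√(b - η)_+`. -/
theorem softUnit_mul_sqrt_cut {D : Type*} [NonUnitalCStarAlgebra D] (b : D) {η : ℝ} (hη : 0 < η) :
    cfcₙ (softUnit η) b * cfcₙ (fun t : ℝ => √(max (t - η) 0)) b =
      cfcₙ (fun t : ℝ => √(max (t - η) 0)) b := by
  rw [fc_mul (continuous_softUnit hη) (by fun_prop) (softUnit_zero η) (by simp [hη.le])]
  congr 1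
  funext t
  rcases le_total η t with h | h
  · rw [softUnit_of_le hη h, one_mul]
  · rw [max_eq_right (by linarith), Real.sqrt_zero, mul_zero]

section SoftUnit

variable {D : Type*} [NonUnitalCStarAlgebra D] [PartialOrder D] [StarOrderedRing D]

theorem softUnit_fc_nonneg {b : D} (hb : 0 ≤ b) (η : ℝ) : 0 ≤ cfcₙ (softUnit η) b :=
  fc_nonneg hb fun _ _ => softUnit_nonneg _ _

theorem norm_softUnit_fc_le {b : D} (hb : 0 ≤ b) (η : ℝ) : ‖cfcₙ (softUnit η) b‖ ≤ 1 :=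
  norm_fc_le hb fun t ht => by
    rw [abs_of_nonneg (softUnit_nonneg η t)]
    exact softUnit_le_one ht

/-- With d(t) = t max(η, t) one has d² · `softUnit η` = t⁴, and b ≾ b² ≾ b⁴. -/
theorem cuntzLE_softUnit {b : D} (hb : 0 ≤ b) {η : ℝ} (hη : 0 < η) :
    CuntzLE b (cfcₙ (softUnit η) b) := by
  refine (CuntzLE.mul_self hb).trans ((CuntzLE.mul_self ?_).trans
    (.of_eq (d := cfcₙ (fun t : ℝ => t * max η t) b) ?_))
  · simpa [hb.isSelfAdjoint.star_eq] using star_mul_self_nonneg b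
  · have hbb : b * b = cfcₙ (fun t : ℝ => t * t) b := by
      rw [← fc_mul_self continuous_id' rfl hb.isSelfAdjoint, fc_id hb]
    have hs := continuous_softUnit hη
    rw [(fc_isSelfAdjoint _ b).star_eq, fc_mul (by fun_prop) hs (by simp) (softUnit_zero η),
      fc_mul (by fun_prop) (by fun_prop) (by simp) (by simp), hbb,
      fc_mul (by fun_prop) (by fun_prop) (by simp) (by simp)]
    congr 1
    funext t
    have : max η t ≠ 0 := (lt_max_of_lt_left hη).ne'
    rw [softUnit]
    field_simp

theorem softUnit_cuntzLE {b : D} (hb : 0 ≤ b) {η : ℝ} (hη : 0 < η) :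
    CuntzLE (cfcₙ (softUnit η) b) b := by
  have h := CuntzLE.fc_of_le (g := fun t => t) (continuous_softUnit hη) continuous_id'
    (softUnit_zero η) rfl (fun t _ => softUnit_nonneg η t) hb
    (fun ε hε => ⟨1 / η, by positivity, fun t ht => ?_⟩) (fun t ht => ht)
  · rwa [fc_id hb] at h
  · rcases le_total η t with h | h
    · rw [softUnit_of_le hη h]
      have : 1 ≤ 1 / η * t := by rw [one_div, inv_mul_eq_div, one_le_div hη]; exact h
      linarith
    · rw [softUnit_of_ge h]
      have h1 : t / η ≤ 1 := (div_le_one hη).2 h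
      have h2 : 0 ≤ t / η := by positivity
      have h3 : 1 / η * t = t / η := by ring
      nlinarith

/-- If `g` acts as a unit on `b`, it acts as a unit on `softUnit η b`. -/
theorem mul_softUnit_of_mul_eq {b g : D} (hb : 0 ≤ b) (h : g * b = b) {η : ℝ} (hη : 0 < η) :
    g * cfcₙ (softUnit η) b = cfcₙ (softUnit η) b := by
  have hc : Continuous fun t : ℝ => t / max η t := continuous_div_max hη continuous_id'
  have hk : Continuous fun t : ℝ => t / max η t * (max η t)⁻¹ :=
    hc.mul ((by fun_prop : Continuous fun t : ℝ => max η t).inv₀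
      fun _ => (lt_max_of_lt_left hη).ne')
  -- Because `softUnit` is a square, the factor left after extracting b still vanishes at 0, as the
  -- nonunital calculus requires.
  have h1 : cfcₙ (softUnit η) b = b * cfcₙ (fun t : ℝ => t / max η t * (max η t)⁻¹) b := by
    nth_rw 2 [← fc_id hb]
    rw [fc_mul continuous_id' hk rfl (by simp)]
    refine fc_congr hb fun t _ => ?_
    rw [softUnit]
    ring
  rw [h1, ← mul_assoc, h]

/-- If `S = ε g + T` where `0 ≤ g ≤ 1` acts as a unit on `T ≥ 0`, then `(S - ε)_+ = T`. -/
theorem cut_smul_add {g T : D} (hg : 0 ≤ g) (hg1 : ‖g‖ ≤ 1) (hT : 0 ≤ T) (h : g * T = T) {ε : ℝ}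
    (hε : 0 ≤ ε) : cut (ε • g + T) ε = T := by
  have hTg : T * g = T := by
    have := congrArg star h
    rwa [star_mul, hT.isSelfAdjoint.star_eq, hg.isSelfAdjoint.star_eq] at this
  have hS : 0 ≤ ε • g + T := add_nonneg (smul_nonneg hε hg) hT
  apply Unitization.inr_injective (R := ℂ)
  have hgU : (0 : Unitization ℂ D) ≤ 1 - (g : Unitization ℂ D) := by
    rw [sub_nonneg]
    exact (CStarAlgebra.norm_le_one_iff_of_nonneg _ (Unitization.inr_nonneg_iff.2 hg)).1
      (by rwa [Unitization.norm_inr])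
  have hSU : 0 ≤ ((ε • g + T : D) : Unitization ℂ D) := Unitization.inr_nonneg_iff.2 hS
  -- In the unitization, S - ε = T - ε(1 - g) is a difference of orthogonal positive elements, so T
  -- is the positive part.
  have h1 := (CFC.posPart_negPart_unique
    (a := ((ε • g + T : D) : Unitization ℂ D) - algebraMap ℝ _ ε)
    (b := (T : Unitization ℂ D)) (c := ε • (1 - (g : Unitization ℂ D))) (by
      rw [Unitization.inr_add, Unitization.inr_smul, Algebra.algebraMap_eq_smul_one, smul_sub]
      abel) (by
      rw [mul_smul_comm, mul_sub, mul_one, ← Unitization.inr_mul, hTg, sub_self, smul_zero])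
    (Unitization.inr_nonneg_iff.2 hT) (smul_nonneg hε hgU)).1
  rw [cut, Unitization.real_cfcₙ_eq_cfc_inr _ _ (by simp [hε]), ← h1, CFC.posPart_def,
    cfcₙ_eq_cfc]
  have h2 : ((ε • g + T : D) : Unitization ℂ D) - algebraMap ℝ _ ε =
      cfc (fun t : ℝ => t - ε) ((ε • g + T : D) : Unitization ℂ D) := by
    rw [cfc_sub (fun t : ℝ => t) (fun _ => ε) _, cfc_id' ℝ _, cfc_const ε _]
  rw [h2, ← cfc_comp' (fun t : ℝ => t⁺) (fun t : ℝ => t - ε) _]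
  rfl

end SoftUnit

end Realization

/-! ### From a rapidly decreasing sequence of classes to one positive contraction -/

section Chain

variable {A : Type*} [NonUnitalCStarAlgebra A] [PartialOrder A] [StarOrderedRing A]

/-- Interpolation: if `x' ≪ x ≤ [b]` with `b` in `A`, there is `b'` in the hereditary subalgebra of
some `(b - η)_+` with `x' ≤ [b'] ≤ x`. -/
theorem exists_interpolation {x' x : Cu A} {b : A} (hb : 0 ≤ b) (hx : FarBelow x' x)
    (hxb : x ≤ Cu.ofElem b hb) :
    ∃ η > 0, ∃ (b' : A) (hb' : 0 ≤ b'), cfcₙ (softUnit η) b * b' = b' ∧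
      x' ≤ Cu.ofElem b' hb' ∧ Cu.ofElem b' hb' ≤ x := by
  obtain ⟨a, ha, rfl⟩ := x.exists_rep
  obtain ⟨ε, hε, hx'⟩ := hx.exists_cut ha
  have hcb : 0 ≤ corner b := map_pos_elem corner hb
  -- The budget ε is split in three: one third to cut a, one to approximate the result by c = d^* (b
  -- - η)_+ d, one to cut c.
  obtain ⟨η, hη, hab⟩ := CuntzLE.exists_cut ha hcb hxb (ε := ε / 3) (by positivity)
  rw [← corner_cut hb hη.le, cuntzLE_iff_mem_closure, Metric.mem_closure_iff] at hab
  obtain ⟨_, ⟨d, rfl⟩, hd⟩ := hab (ε / 3) (by positivity)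
  rw [dist_eq_norm] at hd
  set q := cfcₙ (fun t : ℝ => √(max (t - η) 0)) b with hq
  have hqs : star q = q := (fc_isSelfAdjoint _ b).star_eq
  have hqq : q * q = cut b η := by
    rw [hq, fc_mul (by fun_prop) (by fun_prop) (by simp [hη.le]) (by simp [hη.le]), cut]
    congr 1
    funext t
    exact Real.mul_self_sqrt (le_max_right _ _)
  set y := corner q * d with hy
  set c := star d * corner (cut b η) * d with hc
  have hyc : star y * y = c := by
    rw [hc, ← hqq, map_mul, hy, star_mul, ← map_star, hqs]
    noncomm_ring
  have hc0 : 0 ≤ c := hyc ▸ star_mul_self_nonneg y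
  -- Chosen so that t κ(t)² = (t - ε/3)_+ for t ≥ 0, which makes (y w)^*(y w) the cut-down of c.
  set κ : ℝ → ℝ := fun t => √(max (t - ε / 3) 0 / max (ε / 3) t) with hκ
  have hκc : Continuous κ :=
    Real.continuous_sqrt.comp (continuous_div_max (by positivity) (by fun_prop))
  have hκ0 : κ 0 = 0 := by
    have : (0 : ℝ) - ε / 3 ≤ 0 := by linarith
    simp only [hκ]
    rw [max_eq_right this, zero_div, Real.sqrt_zero]
  set w := cfcₙ κ c with hw
  have hws : star w = w := (fc_isSelfAdjoint κ c).star_eq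
  have hz : star (y * w) * (y * w) = cut c (ε / 3) := by
    have h1 : star (y * w) * (y * w) = w * (star y * y) * w := by
      rw [star_mul, hws]; noncomm_ring
    rw [h1, hyc, hw, fc_mul_self hκc hκ0 hc0.isSelfAdjoint,
      fc_mul (by fun_prop) hκc (by simp) hκ0, cut]
    refine fc_congr hc0 fun t ht => ?_
    have h2 : 0 ≤ max (t - ε / 3) 0 / max (ε / 3) t :=
      div_nonneg (le_max_right _ _) (ht.trans (le_max_right _ _))
    have h3 : κ t * t * κ t = max (t - ε / 3) 0 / max (ε / 3) t * t := by
      rw [mul_right_comm, Real.mul_self_sqrt h2]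
    rw [h3]
    rcases le_total (ε / 3) t with h | h
    · rw [max_eq_right h, div_mul_cancel₀]
      linarith
    · rw [max_eq_right (by linarith)]
      simp
  -- Passing from (y w)^*(y w) to (y w)(y w)^* keeps the Cuntz class and moves the element into the
  -- corner, since y begins with q.
  obtain ⟨b', hb'⟩ := exists_corner_eq_compress q q (d * w * star (d * w))
  have hbz : corner b' = y * w * star (y * w) := by
    rw [hb', hy]
    simp only [star_mul, ← map_star, hqs]
    noncomm_ring
  have hb'0 : 0 ≤ b' := nonneg_of_corner_nonneg (hbz ▸ mul_star_self_nonneg _)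
  have hunit : cfcₙ (softUnit η) b * b' = b' := by
    refine corner_injective ?_
    rw [map_mul, hb']
    have h1 : corner (cfcₙ (softUnit η) b) * corner q = corner q := by
      rw [← map_mul, softUnit_mul_sqrt_cut b hη]
    rw [← mul_assoc, ← mul_assoc, h1]
  refine ⟨η, hη, b', hb'0, hunit, hx'.trans ?_, ?_⟩
  · change CuntzLE (cut a ε) (corner b')
    rw [hbz]
    refine CuntzLE.trans ?_ CuntzLE.star_mul_self
    rw [hz]
    have h1 : cut a ε = cut (cut a (ε / 3)) (ε / 3 + ε / 3) := by
      rw [cut_cut ha (by positivity) (by positivity)]; congr 1; ring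
    rw [h1]
    refine CuntzLE.cut_of_norm_le (cut_nonneg ha _) (cut_nonneg hc0 _) (by positivity) ?_
    have h2 := norm_sub_cut_le hc0 (t := ε / 3) (by positivity)
    have h3 := norm_sub_le_norm_sub_add_norm_sub (cut a (ε / 3)) c (cut c (ε / 3))
    linarith
  · change CuntzLE (corner b') a
    rw [hbz]
    refine CuntzLE.trans CuntzLE.mul_star_self ?_
    rw [hz]
    refine CuntzLE.trans ?_ (CuntzLE.cut_self ha (t := ε / 3) (by positivity))
    exact CuntzLE.cut_of_norm_le hc0 (cut_nonneg ha _) (by positivity)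
      (by rw [norm_sub_rev]; exact hd.le)

/-- A rapidly decreasing sequence of Cuntz classes below `[h]` is interlaced with the classes of a
sequence of positive contractions of `A`, each a unit for the next. -/
theorem exists_contractions {h : A} (hh : 0 ≤ h) (x : ℕ → Cu A)
    (hx : ∀ i, FarBelow (x (i + 1)) (x i)) (hx0 : x 0 ≤ Cu.ofElem h hh) :
    ∃ (g : ℕ → A) (hg : ∀ i, 0 ≤ g i), (∀ i, ‖g i‖ ≤ 1) ∧ (∀ i, g i * g i ≤ g i) ∧
      (∀ i, g i * g (i + 1) = g (i + 1)) ∧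
      ∀ i, x (i + 1) ≤ Cu.ofElem (g i) (hg i) ∧ Cu.ofElem (g i) (hg i) ≤ x i := by
  let S : ℕ → Type _ := fun i => {b : A // ∃ hb : 0 ≤ b, x i ≤ Cu.ofElem b hb}
  have hstep : ∀ i (s : S i), ∃ η > 0, ∃ s' : S (i + 1),
      cfcₙ (softUnit η) s.1 * s'.1 = s'.1 ∧ Cu.ofElem s'.1 s'.2.1 ≤ x i := by
    rintro i ⟨b, hb, hxb⟩
    obtain ⟨η, hη, b', hb', h1, h2, h3⟩ := exists_interpolation hb (hx i) hxb
    exact ⟨η, hη, ⟨b', hb', h2⟩, h1, h3⟩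
  choose η hη nxt hunit hle using hstep
  let s : ∀ i, S i := fun i => Nat.rec ⟨h, hh, hx0⟩ (fun i s => nxt i s) i
  have hb : ∀ i, 0 ≤ (s i).1 := fun i => (s i).2.1
  let ρ : ℕ → ℝ := fun i => η i (s i)
  have hρ : ∀ i, 0 < ρ i := fun i => hη i (s i)
  -- The shift by one discards h itself: s_{i+1} is the first element known to lie between x_{i+1}
  -- and x_i.
  refine ⟨fun i => cfcₙ (softUnit (ρ (i + 1))) (s (i + 1)).1,
    fun i => softUnit_fc_nonneg (hb (i + 1)) _, fun i => norm_softUnit_fc_le (hb (i + 1)) _,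
    fun i => ?_, fun i => ?_, fun i => ⟨(s (i + 1)).2.2.trans ?_, le_trans ?_ (hle i (s i))⟩⟩
  · have hc := continuous_softUnit (hρ (i + 1))
    rw [fc_mul hc hc (softUnit_zero _) (softUnit_zero _)]
    refine fc_mono (by fun_prop) hc (by simp [softUnit_zero]) (softUnit_zero _)
      (hb (i + 1)) fun t ht => ?_
    exact mul_le_of_le_one_left (softUnit_nonneg _ _) (softUnit_le_one ht)
  · exact mul_softUnit_of_mul_eq (hb (i + 1 + 1)) (hunit (i + 1) (s (i + 1))) (hρ _)
  · exact Cu.ofElem_le_ofElem _ _ (cuntzLE_softUnit (hb (i + 1)) (hρ (i + 1)))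
  · exact Cu.ofElem_le_ofElem _ _ (softUnit_cuntzLE (hb (i + 1)) (hρ (i + 1)))

theorem mul_eq_of_lt {M : Type*} [Semigroup M] {g : ℕ → M}
    (hu : ∀ i, g i * g (i + 1) = g (i + 1)) {i k : ℕ} (h : i < k) :
    g i * g k = g k := by
  induction k, h using Nat.le_induction with
  | base => exact hu i
  | succ k _ ih => rw [← hu k, ← mul_assoc, ih]

/-- A rapidly decreasing sequence of classes below `[h]`, vanishing at the `n`-th term, is
interlaced with the cut-downs of one positive contraction of `A`. -/
theorem exists_interlaced {h : A} (hh : 0 ≤ h) (x : ℕ → Cu A)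
    (hx : ∀ i, FarBelow (x (i + 1)) (x i)) (hx0 : x 0 ≤ Cu.ofElem h hh) {n : ℕ} (hn : 0 < n)
    (hxn : ∀ i, n ≤ i → x i = 0) :
    ∃ (b : A) (hb : 0 ≤ b), ‖b‖ ≤ 1 ∧ ∀ i : ℕ,
      x (i + 1) ≤ Cu.ofElem (cut b (i / n)) (cut_nonneg hb _) ∧
      Cu.ofElem (cut b (i / n)) (cut_nonneg hb _) ≤ x i := by
  obtain ⟨g, hg, hg1, hgg, hu, hxg⟩ := exists_contractions hh x hx hx0
  set r : ℝ := 1 / n with hr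
  have hn' : (0 : ℝ) < n := by exact_mod_cast hn
  have hr0 : 0 < r := by positivity
  set T : ℕ → A := fun i => ∑ k ∈ Finset.Ico i n, r • g k with hT
  have hT0 : ∀ i, 0 ≤ T i := fun i => Finset.sum_nonneg fun k _ => smul_nonneg hr0.le (hg k)
  have hTz : ∀ i, n ≤ i → T i = 0 := fun i hi => by simp [hT, Finset.Ico_eq_empty_of_le hi]
  have hTs : ∀ i, i < n → T i = r • g i + T (i + 1) := fun i hi =>
    Finset.sum_eq_sum_Ico_succ_bot hi _
  have hgT : ∀ i, g i * T (i + 1) = T (i + 1) := fun i => by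
    simp only [hT, Finset.mul_sum]
    refine Finset.sum_congr rfl fun k hk => ?_
    rw [mul_smul_comm, mul_eq_of_lt hu (Finset.mem_Ico.1 hk).1]
  have hcut : ∀ i : ℕ, cut (T 0) (i * r) = T i := by
    intro i
    induction i with
    | zero => rw [Nat.cast_zero, zero_mul, cut_zero (hT0 0)]
    | succ i ih =>
      -- Each further cut by r strips the leading term r g_i off the tail, on whose remainder g_i is
      -- a unit.
      rw [Nat.cast_succ, add_one_mul, ← cut_cut (hT0 0) (by positivity) hr0.le, ih]
      rcases lt_or_ge i n with hi | hi
      · rw [hTs i hi]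
        exact cut_smul_add (hg i) (hg1 i) (hT0 _) (hgT i) hr0.le
      · rw [hTz i hi, hTz (i + 1) (by omega), cut]
        exact cfcₙ_apply_zero
  have hTn : ‖T 0‖ ≤ 1 := by
    refine (norm_sum_le _ _).trans ?_
    calc ∑ k ∈ Finset.Ico 0 n, ‖r • g k‖ ≤ ∑ k ∈ Finset.Ico 0 n, r := by
          refine Finset.sum_le_sum fun k _ => ?_
          rw [norm_smul, Real.norm_of_nonneg hr0.le]
          exact mul_le_of_le_one_right hr0.le (hg1 k)
      _ = 1 := by
          rw [Finset.sum_const, Nat.card_Ico, nsmul_eq_mul, hr, Nat.sub_zero]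
          field_simp
  refine ⟨T 0, hT0 0, hTn, fun i => ?_⟩
  have hci : cut (T 0) (i / n) = T i := by rw [← hcut i, hr]; congr 1; ring
  have hcl : Cu.ofElem (cut (T 0) (i / n)) (cut_nonneg (hT0 0) _) = Cu.ofElem (T i) (hT0 i) := by
    congr 1
  rw [hcl]
  rcases lt_or_ge i n with hi | hi
  · have h1 : CuntzLE (g i) (T i) := by
      refine .of_le_smul (hg i) hn'.le ?_
      rw [hTs i hi, smul_add, smul_smul, hr, mul_one_div_cancel hn'.ne', one_smul]
      exact le_add_of_nonneg_right (smul_nonneg hn'.le (hT0 _))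
    -- Since g_i is a unit on T_{i+1}, one has T_{i+1} = g_i T_{i+1} g_i ≤ ‖T_{i+1}‖ g_i² ≤
    -- ‖T_{i+1}‖ g_i.
    have h2 : CuntzLE (T i) (g i) := by
      refine .of_le_smul (r := r + ‖T (i + 1)‖) (hT0 i) (by positivity) ?_
      rw [hTs i hi, add_smul]
      refine add_le_add_right ?_ _
      have hgs : star (g i) = g i := (hg i).isSelfAdjoint.star_eq
      have h3 : star (g i) * T (i + 1) * g i = T (i + 1) := by
        have h4 := congrArg star (hgT i)
        rw [star_mul, (hT0 _).isSelfAdjoint.star_eq, hgs] at h4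
        rw [hgs, hgT, h4]
      calc T (i + 1) = star (g i) * T (i + 1) * g i := h3.symm
        _ ≤ ‖T (i + 1)‖ • (star (g i) * g i) :=
          CStarAlgebra.star_left_conjugate_le_norm_smul (hT0 _).isSelfAdjoint
        _ ≤ ‖T (i + 1)‖ • g i := by
          rw [hgs]
          exact smul_le_smul_of_nonneg_left (hgg i) (norm_nonneg _)
    exact ⟨(hxg i).1.trans (Cu.ofElem_le_ofElem _ _ h1),
      (Cu.ofElem_le_ofElem _ _ h2).trans (hxg i).2⟩
  · have h1 : Cu.ofElem (T i) (hT0 i) = 0 := by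
      refine le_antisymm ?_ (Cu.zero_le _)
      change CuntzLE (corner (T i)) 0
      rw [hTz i hi, map_zero]
      exact CuntzLE.zero_left _
    rw [h1, hxn (i + 1) (by omega), hxn i hi]
    exact ⟨le_rfl, le_rfl⟩

end Chain

/-! ### The homomorphism from the cone given by a positive contraction -/

section ConeHom

/-- Extension by zero of an element of `C_0(0,1]`. -/
def coneExt (f : Cone) (r : ℝ) : ℂ := if h : r ∈ Set.Ioc (0 : ℝ) 1 then f ⟨r, h⟩ else 0

/-- At 0 this is exactly vanishing at infinity: a compact subset of (0,1] is closed in ℝ and misses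
0. -/
theorem continuousOn_coneExt (f : Cone) : ContinuousOn (coneExt f) (Set.Icc 0 1) := by
  intro r hr
  rcases hr.1.eq_or_lt with rfl | hr0
  · refine ContinuousAt.continuousWithinAt ?_
    rw [Metric.continuousAt_iff']
    intro ε hε
    obtain ⟨K, hK, hKε⟩ := mem_cocompact.1 (Metric.tendsto_nhds.1 f.zero_at_infty' ε hε)
    have h1 : IsClosed (Subtype.val '' K) := (hK.image continuous_subtype_val).isClosed
    have h2 : (0 : ℝ) ∈ (Subtype.val '' K)ᶜ := by
      rintro ⟨x, _, hx⟩
      exact x.2.1.ne' hx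
    filter_upwards [h1.isOpen_compl.mem_nhds h2] with s hs
    simp only [coneExt, Set.mem_Ioc, lt_self_iff_false, false_and, dite_false]
    split_ifs with h
    · exact hKε (show (⟨s, h⟩ : Set.Ioc (0 : ℝ) 1) ∈ Kᶜ from fun hsK => hs ⟨_, hsK, rfl⟩)
    · simpa using hε
  · have h1 : ContinuousOn (coneExt f) (Set.Ioc 0 1) := by
      rw [continuousOn_iff_continuous_domRestrict]
      refine f.continuous.congr fun x => ?_
      simp [coneExt]
    refine (h1 r ⟨hr0, hr.2⟩).mono_of_mem_nhdsWithin ?_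
    filter_upwards [self_mem_nhdsWithin, mem_nhdsWithin_of_mem_nhds (lt_mem_nhds hr0)] with s hs hs0
    exact ⟨hs0, hs.2⟩

theorem coneExt_zero (f : Cone) : coneExt f 0 = 0 := by simp [coneExt]

variable {A : Type*} [NonUnitalCStarAlgebra A] [PartialOrder A] [StarOrderedRing A]

theorem mem_Icc_of_mem_quasispectrum {b : A} (hb : 0 ≤ b) (hb1 : ‖b‖ ≤ 1) {z : ℂ}
    (hz : z ∈ quasispectrum ℂ b) : z.re ∈ Set.Icc (0 : ℝ) 1 := by
  refine ⟨(Complex.nonneg_iff.1 (quasispectrum_nonneg_of_nonneg b hb z hz)).1, ?_⟩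
  rw [Unitization.quasispectrum_eq_spectrum_inr' ℂ ℂ] at hz
  have h1 := spectrum.norm_le_norm_of_mem hz
  rw [Unitization.norm_inr] at h1
  exact (Complex.re_le_norm z).trans (h1.trans hb1)

theorem continuousOn_coneExt_re {b : A} (hb : 0 ≤ b) (hb1 : ‖b‖ ≤ 1) (f : Cone) :
    ContinuousOn (fun z : ℂ => coneExt f z.re) (quasispectrum ℂ b) :=
  (continuousOn_coneExt f).comp Complex.continuous_re.continuousOn
    fun _ hz => mem_Icc_of_mem_quasispectrum hb hb1 hz

/-- The *-homomorphism `C_0(0,1] → A` sending `id` to a positive contraction. -/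
def coneHom (b : A) (hb : 0 ≤ b) (hb1 : ‖b‖ ≤ 1) : Cone →⋆ₙₐ[ℂ] A where
  toFun f := cfcₙ (fun z : ℂ => coneExt f z.re) b
  map_smul' c f := by
    rw [MonoidHom.id_apply, ← cfcₙ_smul c _ b (continuousOn_coneExt_re hb hb1 f) (coneExt_zero f)]
    congr 1
    funext z
    by_cases h : z.re ∈ Set.Ioc (0 : ℝ) 1 <;> simp [coneExt, h]
  map_zero' := by
    rw [← cfcₙ_const_zero ℂ b]
    congr 1
    funext z
    by_cases h : z.re ∈ Set.Ioc (0 : ℝ) 1 <;> simp [coneExt, h]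
  map_add' f g := by
    rw [← cfcₙ_add _ _ b (continuousOn_coneExt_re hb hb1 f) (coneExt_zero f)
      (continuousOn_coneExt_re hb hb1 g) (coneExt_zero g)]
    congr 1
    funext z
    by_cases h : z.re ∈ Set.Ioc (0 : ℝ) 1 <;> simp [coneExt, h]
  map_mul' f g := by
    rw [← cfcₙ_mul _ _ b (continuousOn_coneExt_re hb hb1 f) (coneExt_zero f)
      (continuousOn_coneExt_re hb hb1 g) (coneExt_zero g)]
    congr 1
    funext z
    by_cases h : z.re ∈ Set.Ioc (0 : ℝ) 1 <;> simp [coneExt, h]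
  map_star' f := by
    rw [← cfcₙ_star]
    congr 1
    funext z
    by_cases h : z.re ∈ Set.Ioc (0 : ℝ) 1 <;> simp [coneExt, h]

theorem coneHom_cutFun (b : A) (hb : 0 ≤ b) (hb1 : ‖b‖ ≤ 1) (t : NNReal) :
    coneHom b hb hb1 (cutFun t) = cut b t := by
  rw [cut, cfcₙ_real_eq_complex _ hb.isSelfAdjoint]
  refine cfcₙ_congr fun z hz => ?_
  obtain ⟨h0, h1⟩ := mem_Icc_of_mem_quasispectrum hb hb1 hz
  simp only [coneExt]
  split_ifs with h
  · rfl
  · have : z.re = 0 := by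
      by_contra hne
      exact h ⟨lt_of_le_of_ne h0 (Ne.symm hne), h1⟩
    rw [this, max_eq_right (by simp), Complex.ofReal_zero]

theorem map_coneHom_cutClass (b : A) (hb : 0 ≤ b) (hb1 : ‖b‖ ≤ 1) (t : NNReal) :
    Cu.map (coneHom b hb hb1) (cutClass t) = Cu.ofElem (cut b t) (cut_nonneg hb _) := by
  have h1 : Stab.map (coneHom b hb hb1) (corner (cutFun t)) = corner (cut b t) := by
    rw [Stab.map_corner, coneHom_cutFun]
  exact congrArg (toAntisymmetrization (α := StabPos A) (· ≤ ·)) (StabPos.ext h1)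

end ConeHom

end

end CuntzSemigroup

/-! ### Discretization of α and the distance estimate -/

theorem mainTheorem7 {A : Type*} [NonUnitalCStarAlgebra A] [PartialOrder A] [StarOrderedRing A]
    (h : A) (hh : CuntzSemigroup.StrictlyPositive h)
    (α : CuntzSemigroup.Cu CuntzSemigroup.Cone → CuntzSemigroup.Cu A)
    (hα : CuntzSemigroup.IsCuMorphism α)
    (hle : α (CuntzSemigroup.Cu.ofElem CuntzSemigroup.idFun CuntzSemigroup.idFun_nonneg) ≤
      CuntzSemigroup.Cu.ofElem h hh.1)
    (ε : ℝ) (hε : 0 < ε) :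
    ∃ φ : CuntzSemigroup.Cone →⋆ₙₐ[ℂ] A,
      (CuntzSemigroup.dW (CuntzSemigroup.Cu.map φ) α : ℝ) < ε := by
  open CuntzSemigroup in
  obtain ⟨m, hm⟩ := exists_nat_gt (2 / ε)
  set n := m + 1 with hn
  have hn0 : 0 < n := m.succ_pos
  have hn' : (0 : NNReal) < n := by exact_mod_cast hn0
  have hnε : (2 : ℝ) / n < ε := by
    rw [div_lt_comm₀ (by exact_mod_cast hn0) hε]
    refine hm.trans ?_
    rw [hn]
    push_cast
    linarith
  let τ : ℕ → NNReal := fun i => i / n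
  have hτ : ∀ i, τ i < τ (i + 1) := fun i => by
    simp only [τ]
    gcongr
    simp
  have hid : Cu.ofElem idFun idFun_nonneg = cutClass (τ 0) :=
    congrArg (toAntisymmetrization (α := StabPos Cone) (· ≤ ·))
      (StabPos.ext (congrArg corner (by simp [τ, idFun_eq])))
  obtain ⟨b, hb, hb1, hint⟩ := exists_interlaced hh.1 (fun i => α (cutClass (τ i)))
    (fun i => hα.map_farBelow _ _ (cutClass_farBelow (hτ i))) (by rwa [← hid]) hn0
    (fun i hi => by
      rw [cutClass_eq_zero, hα.map_zero]
      rw [one_le_div hn']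
      exact_mod_cast hi)
  refine ⟨coneHom b hb hb1, lt_of_le_of_lt ?_ hnε⟩
  have hmem : (2 / n : NNReal) ∈ dWSet (Cu.map (coneHom b hb hb1)) α := by
    intro t
    -- Of the allowance 2/n, one step covers rounding t to the grid and the other the gap between
    -- x_{i+1} and x_{i+2} left by the interlacing.
    obtain ⟨i, hi1, hi2⟩ : ∃ i : ℕ, τ i ≤ t ∧ t ≤ τ (i + 1) := by
      refine ⟨⌊t * n⌋₊, ?_, ?_⟩
      · rw [div_le_iff₀ hn']
        exact Nat.floor_le zero_le
      · rw [le_div_iff₀ hn']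
        exact_mod_cast (Nat.lt_floor_add_one (t * n)).le
    have hi3 : τ (i + 2) ≤ t + 2 / n := by
      have : τ (i + 2) = τ i + 2 / n := by simp only [τ]; push_cast; rw [add_div]
      rw [this]
      gcongr
    have hi4 : τ (i + 1) ≤ t + 2 / n := (hτ (i + 1)).le.trans hi3
    have hcls : ∀ j, Cu.map (coneHom b hb hb1) (cutClass (τ j)) =
        Cu.ofElem (cut b (j / n)) (cut_nonneg hb _) := fun j => by
      rw [map_coneHom_cutClass]
      congr 2
    have hmono : Monotone (Cu.map (coneHom b hb hb1)) := OrderHom.monotone _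
    constructor
    · refine (hmono (cutClass_antitone hi4)).trans ?_
      rw [hcls]
      exact (hint (i + 1)).2.trans (hα.monotone (cutClass_antitone hi2))
    -- Here both steps are used: α([e_{t+2/n}]) ≤ x_{i+2} ≤ [(b - (i+1)/n)_+], and the last class is
    -- the image of [e_{(i+1)/n}] ≤ [e_t].
    · refine le_trans ?_ (hmono (cutClass_antitone hi2))
      rw [hcls]
      exact (hα.monotone (cutClass_antitone hi3)).trans (hint (i + 1)).1
  have h1 : dW (Cu.map (coneHom b hb hb1)) α ≤ 2 / n := csInf_le (OrderBot.bddBelow _) hmem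
  exact_mod_cast h1
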